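/- Let $\Omega=\{0,1\}^{\mathbb N}$ be the Cantor space and let $\mathrm{Homeo}(\Omega)$ carry the topology of uniform convergence. For a group $G$, let $\Xi(G)=\mathrm{Hom}(G,\mathrm{Homeo}(\Omega))$ be the space of actions of $G$ on $\Omega$ by homeomorphisms, with the subspace topology from the product $\mathrm{Homeo}(\Omega)^G$, and let $\Xi_{\mathrm{tr}}(G)\subseteq\Xi(G)$ be the subspace of topologically transitive actions, i.e. those $\xi$ such that for all non-empty open $U,V\subseteq\Omega$ there is $g\in G$ with $\xi(g)(U)\cap V\neq\emptyset$. The conjugacy class of $\xi\in\Xi(G)$ is $\{f\xi f^{-1} : f\in\mathrm{Homeo}(\Omega)\}$, where $(f\xi f^{-1})(g)=f\,\xi(g)\,f^{-1}$. A group is polycyclic if it has a finite subnormal series $1=H_0\trianglelefteq H_1\trianglelefteq\cdots\trianglelefteq H_n$, ending in the whole group, with all quotients $H_{i+1}/H_i$ cyclic; it is virtually polycyclic (respectively, virtually cyclic) if it has a polycyclic (respectively, cyclic) subgroup of finite index. **Theorem.** Let $G$ be an infinite, virtually polycyclic group. Then there is $\xi\in\Xi_{\mathrm{tr}}(G)$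 whose conjugacy class is dense in $\Xi_{\mathrm{tr}}(G)$ if and only if $G$ is virtually cyclic. -/

import Mathlib

open scoped Pointwise

namespace CantorDynamics

/-- The Cantor space `Ω = {0,1}^ℕ`, with its product topology and uniformity. -/
abbrev Cantor : Type := ℕ → Bool

/-- `Homeo(Ω)`, a group under composition (`f * g = f ∘ g`). -/
abbrev HomeoCantor : Type := Cantor ≃ₜ Cantor

/-- The topology of uniform convergence on `Homeo(Ω)`. -/
instance instTopologicalSpaceHomeoCantor : TopologicalSpace HomeoCantor :=
  TopologicalSpace.induced (fun f : HomeoCantor => UniformFun.ofFun (f : Cantor → Cantor))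
    inferInstance

/-- The space `Ξ(G) = Hom(G, Homeo(Ω))` of actions of `G` on the Cantor space by
homeomorphisms. -/
abbrev CantorAction (G : Type*) [Group G] : Type _ := G →* HomeoCantor

/-- The topology on `Ξ(G)` as a subspace of the product `Homeo(Ω)^G`. -/
instance instTopologicalSpaceCantorAction (G : Type*) [Group G] :
    TopologicalSpace (CantorAction G) :=
  TopologicalSpace.induced (fun (ξ : CantorAction G) (g : G) => ξ g) inferInstance

/-- Topological transitivity of an action `ξ ∈ Ξ(G)`: for all non-empty open `U, V ⊆ Ω`
there is `g ∈ G` such that `ξ(g)(U) ∩ V` is non-empty. -/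
def IsTransitive {G : Type*} [Group G] (ξ : CantorAction G) : Prop :=
  ∀ U V : Set Cantor, IsOpen U → U.Nonempty → IsOpen V → V.Nonempty →
    ∃ g : G, ((ξ g '' U) ∩ V).Nonempty

/-- `IsTransitive` is Mathlib's topological transitivity of the action of `G` on `Ω`
given by `g • x = ξ(g)(x)`. -/
theorem isTransitive_iff {G : Type*} [Group G] (ξ : CantorAction G) [MulAction G Cantor]
    (h : ∀ (g : G) (x : Cantor), g • x = ξ g x) :
    IsTransitive ξ ↔ MulAction.IsTopologicallyTransitive G Cantor := by
  have key : ∀ (g : G) (U : Set Cantor), g • U = ξ g '' U := fun g U => by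
    rw [← Set.image_smul]
    exact Set.image_congr fun x _ => h g x
  rw [MulAction.isTopologicallyTransitive_iff]
  simp only [key]
  exact ⟨fun H U V => H U V, fun H U V => H⟩

/-- The space `Ξ_tr(G)` of topologically transitive actions of `G` on the Cantor space, as a
subset of `Ξ(G)`; its coercion to a type carries the subspace topology. -/
def transitiveActions (G : Type*) [Group G] : Set (CantorAction G) :=
  {ξ | IsTransitive ξ}

/-- The conjugation action of `Homeo(Ω)` on `Ξ(G)`: `(f · ξ)(g) = f ξ(g) f⁻¹`. -/
def conjAction {G : Type*} [Group G] (f : HomeoCantor) (ξ : CantorAction G) : CantorAction G :=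
  (MulAut.conj f).toMonoidHom.comp ξ

theorem conjAction_apply {G : Type*} [Group G] (f : HomeoCantor) (ξ : CantorAction G) (g : G) :
    conjAction f ξ g = f * ξ g * f⁻¹ := rfl

/-- The conjugacy class of `ξ`: its orbit under conjugation by `Homeo(Ω)`. -/
def conjClass {G : Type*} [Group G] (ξ : CantorAction G) : Set (CantorAction G) :=
  Set.range fun f : HomeoCantor => conjAction f ξ

/-- `Ξ_tr(G)` has a dense conjugacy class: there is `ξ ∈ Ξ_tr(G)` whose conjugacy class is
dense in the topological space `Ξ_tr(G)`. -/
def HasDenseConjClass (G : Type*) [Group G] : Prop :=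
  ∃ ξ ∈ transitiveActions G,
    Dense {η : transitiveActions G | (η : CantorAction G) ∈ conjClass ξ}

end CantorDynamics

/-- A group is polycyclic if it has a finite subnormal series
`1 = H₀ ⊴ H₁ ⊴ ⋯ ⊴ Hₙ = G` with all quotients `Hᵢ₊₁ / Hᵢ` cyclic. -/
def IsPolycyclic (G : Type*) [Group G] : Prop :=
  ∃ (n : ℕ) (H : ℕ → Subgroup G), H 0 = ⊥ ∧ H n = ⊤ ∧
    ∀ i < n, H i ≤ H (i + 1) ∧
      ∃ _ : ((H i).subgroupOf (H (i + 1))).Normal,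
        IsCyclic (H (i + 1) ⧸ (H i).subgroupOf (H (i + 1)))

/-- A group is virtually polycyclic if it has a polycyclic subgroup of finite index. -/
def IsVirtuallyPolycyclic (G : Type*) [Group G] : Prop :=
  ∃ H : Subgroup G, H.FiniteIndex ∧ IsPolycyclic H

/-- A group is virtually cyclic if it has a cyclic subgroup of finite index. -/
def IsVirtuallyCyclic (G : Type*) [Group G] : Prop :=
  ∃ H : Subgroup G, H.FiniteIndex ∧ IsCyclic H

/-! If `G` is not virtually cyclic, isolable subgroups obstruct density. For `A` infinite and
isolable, the orbit closure of its coloring times a full shift carries a transitive action, and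
every action close to it has a non-empty open set whose return times all lie in `A`. Hence so does
any `ξ` with dense class (`exists_isOpen_returns_subset`). Given `A` and `B`, transitivity makes the
two open sets overlap after a translation. The overlap has infinitely many return times, all in `A`
and in a conjugate of `B`, which is absurd if these intersections are finite
(`not_hasDenseConjClass`). Finite generation of subgroups of polycyclic groups makes isolability
enforceable by finite windows, and homomorphisms from a finite index subgroup to the integers supply
the pair (`exists_isolable_pair`).

Conversely, if `t` has infinite order and generates a subgroup of finite index, the odometer has
dense class. By recurrence, the patterns that a transitive action shows in a finite window are
exactly those of some coloring of period `t ^ m` (`exists_periodic_coloring`). The odometer factors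
onto `G ⧸ zpowers (t ^ m)` and so realises the same patterns. Two partitions of the Cantor space
indexed by the same patterns differ by a homeomorphism (`exists_homeomorph_comp_eq`), which
conjugates the odometer close to the given action. -/

/-! ### Brouwer's characterization of the Cantor space -/

open TopologicalSpace in
-- One step of a binary tree of clopen sets: cut along `B` whenever `B` cuts `C`, which will
-- separate points, and otherwise anywhere, so that no branch dies.
theorem exists_clopen_split {X : Type*} [TopologicalSpace X] [CompactSpace X] [T2Space X]
    [TotallyDisconnectedSpace X] (hX : ∀ x : X, ¬ IsOpen {x}) (B C : Clopens X) :
    ∃ S : Clopens X, (C ≠ ⊥ → S ≤ C ∧ S ≠ ⊥ ∧ C \ S ≠ ⊥) ∧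
      (C ⊓ B ≠ ⊥ → C \ B ≠ ⊥ → S = C ⊓ B) := by
  by_cases h : C ⊓ B ≠ ⊥ ∧ C \ B ≠ ⊥
  · refine ⟨C ⊓ B, fun _ => ⟨inf_le_left, h.1, ?_⟩, fun _ _ => rfl⟩
    rw [sdiff_inf_self_left]
    exact h.2
  by_cases hC : C = ⊥
  · exact ⟨⊥, fun h' => (h' hC).elim, fun h1 h2 => (h ⟨h1, h2⟩).elim⟩
  have hne : (C : Set X).Nonempty := by
    by_contra hcon
    exact hC (SetLike.coe_injective (by simpa [Set.not_nonempty_iff_eq_empty] using hcon))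
  obtain ⟨x, hx⟩ := hne
  obtain ⟨y, hy, hxy⟩ : ∃ y ∈ (C : Set X), y ≠ x := by
    by_contra! hcon
    refine hX x ?_
    have : (C : Set X) = {x} := Set.eq_singleton_iff_unique_mem.2 ⟨hx, hcon⟩
    exact this ▸ C.isClopen.isOpen
  obtain ⟨V, hV, hxV, hyV⟩ := exists_isClopen_of_totally_separated hxy.symm
  refine ⟨C ⊓ ⟨V, hV⟩, fun _ => ⟨inf_le_left, ?_, ?_⟩, fun h1 h2 => (h ⟨h1, h2⟩).elim⟩
  · intro h0
    have : x ∈ C ⊓ ⟨V, hV⟩ := ⟨hx, hxV⟩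
    rw [h0] at this
    exact this
  · intro h0
    have : y ∈ C \ (C ⊓ ⟨V, hV⟩) := ⟨hy, fun h' => hyV h'.2⟩
    rw [h0] at this
    exact this

open TopologicalSpace in
/-- **Brouwer's theorem**: a nonempty compact Hausdorff totally disconnected second countable space
without isolated points is homeomorphic to the Cantor space. -/
theorem nonempty_homeomorph_cantor (X : Type*) [TopologicalSpace X] [CompactSpace X] [T2Space X]
    [TotallyDisconnectedSpace X] [SecondCountableTopology X] [Nonempty X]
    (hX : ∀ x : X, ¬ IsOpen {x}) : Nonempty (X ≃ₜ (ℕ → Bool)) := by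
  classical
  have hcount : Countable (Clopens X) := Clopens.countable_iff_secondCountable.2 inferInstance
  obtain ⟨B, hB⟩ := exists_surjective_nat (Clopens X)
  choose S hS hS' using exists_clopen_split hX
  -- `E a n` is the node of depth `n` on the branch `a`, `D x n` is the node containing `x`, and `φ
  -- x` is the branch that `x` follows.
  let D : X → ℕ → Clopens X := fun x n => n.rec ⊤ fun k C =>
    if x ∈ S (B k) C then S (B k) C else C \ S (B k) C
  let E : (ℕ → Bool) → ℕ → Clopens X := fun a n => n.rec ⊤ fun k C =>
    if a k then S (B k) C else C \ S (B k) C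
  let φ : X → ℕ → Bool := fun x n => decide (x ∈ S (B n) (D x n))
  have hDsucc : ∀ x n, D x (n + 1) =
    if x ∈ S (B n) (D x n) then S (B n) (D x n) else D x n \ S (B n) (D x n) := fun x n => rfl
  have hEsucc : ∀ a n, E a (n + 1) =
    if a n then S (B n) (E a n) else E a n \ S (B n) (E a n) := fun x n => rfl
  have hmem : ∀ x n, x ∈ D x n := by
    intro x n
    induction n with
    | zero => trivial
    | succ n ih =>
      rw [hDsucc]
      split_ifs with h
      · exact h
      · exact ⟨ih, h⟩
  have hbot : ∀ {x : X} {C : Clopens X}, x ∈ C → C ≠ ⊥ := by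
    rintro x C hx rfl
    exact hx
  have hDle : ∀ x n, D x (n + 1) ≤ D x n := by
    intro x n
    rw [hDsucc]
    split_ifs with h
    · exact (hS _ _ (hbot (hmem x n))).1
    · exact sdiff_le
  have hDeq : ∀ n x y, y ∈ D x n → D y n = D x n := by
    intro n
    induction n with
    | zero => intros; rfl
    | succ n ih =>
      intro x y hy
      have h1 := ih x y (hDle x n hy)
      rw [hDsucc, h1, hDsucc x]
      rw [hDsucc] at hy
      by_cases hx : x ∈ S (B n) (D x n)
      · rw [if_pos hx] at hy ⊢
        rw [if_pos hy]
      · rw [if_neg hx] at hy ⊢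
        rw [if_neg (show y ∉ S (B n) (D x n) from hy.2)]
  have hcont : Continuous φ := by
    refine continuous_pi fun n => continuous_iff_continuousAt.2 fun x => ?_
    have hev : ∀ᶠ y in nhds x, φ y n = φ x n := by
      filter_upwards [(D x (n + 1)).isClopen.isOpen.mem_nhds (hmem x (n + 1))] with y hy
      have h1 := hDeq n x y (hDle x n hy)
      have hy' : y ∈ D x (n + 1) := hy
      rw [hDsucc] at hy'
      simp only [φ, h1]
      by_cases hx : x ∈ S (B n) (D x n)
      · rw [if_pos hx] at hy'
        simp [hx, hy']
      · rw [if_neg hx] at hy'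
        have : y ∉ S (B n) (D x n) := hy'.2
        simp [hx, this]
    exact continuousAt_const.congr (hev.mono fun y hy => hy.symm)
  have hDE : ∀ x n, D x n = E (φ x) n := by
    intro x n
    induction n with
    | zero => rfl
    | succ n ih =>
      rw [hDsucc, hEsucc, ← ih]
      simp [φ]
  have hinj : Function.Injective φ := by
    intro x y hxy
    by_contra hne
    obtain ⟨V, hV, hxV, hyV⟩ := exists_isClopen_of_totally_separated hne
    obtain ⟨n, hn⟩ := hB ⟨V, hV⟩
    have hD : D x n = D y n := by rw [hDE, hDE, hxy]
    have hx := hmem x n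
    have hy : y ∈ D x n := hD ▸ hmem y n
    have hxB : x ∈ B n := by rw [hn]; exact hxV
    have hyB : y ∉ B n := by rw [hn]; exact hyV
    have hx1 : x ∈ D x n ⊓ B n := ⟨hx, hxB⟩
    have hy1 : y ∈ D x n \ B n := ⟨hy, hyB⟩
    -- `x` and `y` share a node which `B n` properly cuts, so the split made there is the one along
    -- `B n`.
    have hSeq := hS' (B n) (D x n) (hbot hx1) (hbot hy1)
    have h := congrFun hxy n
    have h1 : y ∉ D x n ⊓ B n := fun h => hyB h.2
    simp [φ, ← hD, hSeq, hx1, h1] at h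
  have hsurj : Function.Surjective φ := by
    intro a
    have hEne : ∀ n, E a n ≠ ⊥ := by
      intro n
      induction n with
      | zero =>
        obtain ⟨x⟩ := ‹Nonempty X›
        exact hbot (x := x) trivial
      | succ n ih =>
        rw [hEsucc]
        split_ifs
        · exact (hS _ _ ih).2.1
        · exact (hS _ _ ih).2.2
    have hEne' : ∀ n, (SetLike.coe (E a n)).Nonempty := by
      intro n
      by_contra hcon
      exact hEne n (SetLike.coe_injective (Set.not_nonempty_iff_eq_empty.1 hcon))
    have hEle : ∀ n, E a (n + 1) ≤ E a n := by
      intro n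
      rw [hEsucc]
      split_ifs
      · exact (hS _ _ (hEne n)).1
      · exact sdiff_le
    obtain ⟨x, hx⟩ := IsCompact.nonempty_iInter_of_sequence_nonempty_isCompact_isClosed
      (fun n => SetLike.coe (E a n)) (fun n => hEle n)
      hEne' (E a 0).isClopen.isClosed.isCompact (fun n => (E a n).isClopen.isClosed)
    rw [Set.mem_iInter] at hx
    have hφ : ∀ n, D x n = E a n → φ x n = a n := by
      intro n hn
      have hx' : x ∈ E a (n + 1) := hx (n + 1)
      rw [hEsucc] at hx'
      simp only [φ, hn]
      cases han : a n
      · rw [han, if_neg (by simp)] at hx'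
        simpa using hx'.2
      · rw [han, if_pos rfl] at hx'
        simpa using hx'
    have hDEa : ∀ n, D x n = E a n := by
      intro n
      induction n with
      | zero => rfl
      | succ n ih =>
        have := hφ n ih
        rw [hDsucc, hEsucc, ← this, ih]
        simp [φ, ih]
    exact ⟨x, funext fun n => hφ n (hDEa n)⟩
  exact ⟨Continuous.homeoOfEquivCompactToT2 (f := Equiv.ofBijective φ ⟨hinj, hsurj⟩) hcont⟩

theorem not_isOpen_singleton_pi {ι : Type*} [Infinite ι] (x : ι → Bool) : ¬ IsOpen {x} := by
  classical
  intro h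
  obtain ⟨I, u, hu, hsub⟩ := isOpen_pi_iff.1 h x rfl
  obtain ⟨i, hi⟩ := Infinite.exists_notMem_finset I
  have hmem : Function.update x i (!x i) ∈ (I : Set ι).pi u := by
    intro j hj
    rw [Function.update_of_ne (show j ≠ i by rintro rfl; exact hi hj)]
    exact (hu j hj).2
  have := congrFun (hsub hmem) i
  simp at this

theorem not_isOpen_singleton_subtype {X : Type*} [TopologicalSpace X]
    (hX : ∀ x : X, ¬ IsOpen {x}) {U : Set X} (hU : IsOpen U) (x : U) : ¬ IsOpen {x} := by
  intro h
  refine hX x ?_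
  have := hU.isOpenMap_subtype_val _ h
  simpa using this

theorem infinite_of_isOpen {X : Type*} [TopologicalSpace X] [T1Space X]
    (hX : ∀ x : X, ¬ IsOpen {x}) {U : Set X} (hU : IsOpen U) (hne : U.Nonempty) :
    U.Infinite := by
  intro hfin
  obtain ⟨x, hx⟩ := hne
  refine hX x ?_
  have : {x} = U ∩ (U \ {x})ᶜ := by
    ext y
    simp only [Set.mem_singleton_iff, Set.mem_inter_iff, Set.mem_compl_iff, Set.mem_sdiff]
    constructor
    · rintro rfl; simp [hx]
    · rintro ⟨h1, h2⟩; by_contra h; exact h2 ⟨h1, h⟩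
  rw [this]
  exact hU.inter (hfin.subset Set.sdiff_subset).isClosed.isOpen_compl

/-- Two continuous maps from the Cantor space to a discrete space that have the same range differ by
a homeomorphism. -/
theorem exists_homeomorph_comp_eq {A : Type*} [TopologicalSpace A] [DiscreteTopology A]
    {p q : (ℕ → Bool) → A} (hp : Continuous p) (hq : Continuous q)
    (hpq : Set.range p = Set.range q) :
    ∃ h : (ℕ → Bool) ≃ₜ (ℕ → Bool), ∀ x, p (h x) = q x := by
  -- Each non-empty fibre is clopen, hence itself a Cantor set. Fibres of `q` and `p` over the same
  -- value are thus homeomorphic, and these homeomorphisms glue.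
  have key : ∀ (r : (ℕ → Bool) → A) (_ : Continuous r) (a : A), a ∈ Set.range r →
      Nonempty ({x // r x = a} ≃ₜ (ℕ → Bool)) := by
    intro r hr a ha
    have hclopen : IsClopen {x | r x = a} := (isClopen_discrete {a}).preimage hr
    have : CompactSpace {x // r x = a} :=
      isCompact_iff_compactSpace.1 hclopen.isClosed.isCompact
    have : Nonempty {x // r x = a} := by
      obtain ⟨x, hx⟩ := ha
      exact ⟨⟨x, hx⟩⟩
    have : SecondCountableTopology {x // r x = a} :=
      TopologicalSpace.Subtype.secondCountableTopology {x | r x = a}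
    exact nonempty_homeomorph_cantor _
      (not_isOpen_singleton_subtype not_isOpen_singleton_pi hclopen.isOpen)
  have e : ∀ a : A, Nonempty ({x // q x = a} ≃ₜ {x // p x = a}) := by
    intro a
    by_cases ha : a ∈ Set.range p
    · exact ⟨(key q hq a (hpq ▸ ha)).some.trans (key p hp a ha).some.symm⟩
    · have h1 : IsEmpty {x // q x = a} := ⟨fun x => ha (hpq ▸ ⟨x.1, x.2⟩)⟩
      have h2 : IsEmpty {x // p x = a} := ⟨fun x => ha ⟨x.1, x.2⟩⟩
      exact ⟨Homeomorph.empty⟩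
  replace e := fun a => (e a).some
  let E : (ℕ → Bool) ≃ (ℕ → Bool) :=
    ((Equiv.sigmaFiberEquiv q).symm.trans
      (Equiv.sigmaCongrRight fun a => (e a).toEquiv)).trans (Equiv.sigmaFiberEquiv p)
  have hE : ∀ x a (h : q x = a), E x = (e a ⟨x, h⟩ : ℕ → Bool) := by
    rintro x a rfl
    rfl
  have hcont : Continuous E := by
    refine continuous_iff_continuousAt.2 fun x => ?_
    have hopen : IsOpen {y | q y = q x} := (isOpen_discrete {q x}).preimage hq
    refine ContinuousOn.continuousAt (s := {y | q y = q x}) ?_ (hopen.mem_nhds rfl)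
    rw [continuousOn_iff_continuous_domRestrict]
    have : Set.domRestrict {y | q y = q x} E = fun y => (e (q x) y : ℕ → Bool) := by
      funext y
      exact hE y.1 _ y.2
    rw [this]
    exact continuous_subtype_val.comp (e (q x)).continuous
  refine ⟨Continuous.homeoOfEquivCompactToT2 hcont, fun x => ?_⟩
  change p (E x) = q x
  rw [hE x _ rfl]
  exact (e (q x) ⟨x, rfl⟩).2

/-! ### Neighbourhoods of actions, transitivity and return times -/

namespace CantorDynamics

theorem exists_cantorAction {G X : Type*} [Group G] [TopologicalSpace X] [CompactSpace X]
    [T2Space X] [TotallyDisconnectedSpace X] [SecondCountableTopology X] [Nonempty X]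
    [MulAction G X] [ContinuousConstSMul G X] (hX : ∀ x : X, ¬ IsOpen {x}) :
    ∃ (e : X ≃ₜ Cantor) (η : CantorAction G), ∀ g x, η g (e x) = e (g • x) := by
  obtain ⟨e⟩ := nonempty_homeomorph_cantor X hX
  refine ⟨e, MonoidHom.mk' (fun g => (e.symm.trans (Homeomorph.smul g)).trans e) ?_, ?_⟩
  · intro a b
    ext1 x
    simp [mul_smul]
  · intro g x
    simp

/-- On a compact space the open neighbourhood `P z.1 = P z.2` of the diagonal is an entourage, so
uniformly close maps have equal `P`-values. -/
theorem eventually_eq_of_continuous {G A : Type*} [Group G] [TopologicalSpace A]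
    [DiscreteTopology A] (η : CantorAction G) (F : Finset G) {P : Cantor → A}
    (hP : Continuous P) :
    {ζ : CantorAction G | ∀ h ∈ F, ∀ ω, P (ζ h ω) = P (η h ω)} ∈ nhds η := by
  have hV : {z : Cantor × Cantor | P z.1 = P z.2} ∈ uniformity Cantor := by
    rw [← nhdsSet_diagonal_eq_uniformity]
    refine (IsOpen.mem_nhdsSet ?_).2 ?_
    · exact (isOpen_discrete (Set.diagonal A)).preimage
        ((hP.comp continuous_fst).prodMk (hP.comp continuous_snd))
    · rintro ⟨a, b⟩ h
      exact congrArg P h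
  rw [nhds_induced]
  have h1 : ∀ h ∈ F, {u : G → HomeoCantor | ∀ ω, P (u h ω) = P (η h ω)} ∈
      nhds (fun g => η g) := by
    intro h _
    have h2 : {f : HomeoCantor | ∀ ω, P (f ω) = P (η h ω)} ∈ nhds (η h) := by
      rw [nhds_induced]
      refine ⟨_, (UniformFun.hasBasis_nhds _ _ _).mem_of_mem hV, ?_⟩
      intro f hf ω
      exact (hf ω).symm
    exact (continuous_apply h).continuousAt h2
  have h3 := (Filter.biInter_finset_mem F).2 h1
  refine ⟨_, h3, ?_⟩
  intro ζ hζ h hh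
  simp only [Set.mem_preimage, Set.mem_iInter] at hζ
  exact hζ h hh

/-- Agreement on the first `N` coordinates gives a basis of entourages of the Cantor space. -/
theorem exists_forall_coord_eq_of_mem_nhds {G : Type*} [Group G] {η : CantorAction G}
    {U : Set (CantorAction G)} (hU : U ∈ nhds η) :
    ∃ (F : Finset G) (N : ℕ), ∀ ζ : CantorAction G,
      (∀ h ∈ F, ∀ ω, ∀ i < N, ζ h ω i = η h ω i) → ζ ∈ U := by
  classical
  have hcan : ∀ (h : HomeoCantor) (V : Set HomeoCantor), V ∈ nhds h →
      ∃ N, ∀ f : HomeoCantor, (∀ ω, ∀ i < N, f ω i = h ω i) → f ∈ V := by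
    intro h V hV
    rw [nhds_induced] at hV
    obtain ⟨t, ht, htV⟩ := hV
    obtain ⟨W, hW, hWt⟩ := (UniformFun.hasBasis_nhds _ _ _).mem_iff.1 ht
    have : ∃ N, ∀ a b : Cantor, (∀ i < N, a i = b i) → (a, b) ∈ W := by
      rw [Pi.uniformity, Filter.mem_iInf] at hW
      obtain ⟨I, hI, V, hV, rfl⟩ := hW
      refine ⟨hI.toFinset.sup id + 1, fun a b hab => Set.mem_iInter.2 fun i => ?_⟩
      obtain ⟨t, ht, htV⟩ := hV i
      refine htV ?_
      have hi : a i = b i :=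
        hab i (Nat.lt_succ_of_le (Finset.le_sup (f := id) (hI.mem_toFinset.2 i.2)))
      change (a i, b i) ∈ t
      rw [hi]
      exact refl_mem_uniformity ht
    obtain ⟨N, hN⟩ := this
    exact ⟨N, fun f hf => htV (hWt fun ω => hN _ _ fun i hi => (hf ω i hi).symm)⟩
  rw [nhds_induced] at hU
  obtain ⟨t, ht, htU⟩ := hU
  rw [nhds_pi, Filter.mem_pi] at ht
  obtain ⟨I, hI, V, hV, hsub⟩ := ht
  choose N hN using fun g => hcan (η g) (V g) (hV g)
  refine ⟨hI.toFinset, hI.toFinset.sup N, fun ζ hζ => htU (hsub fun g hg => ?_)⟩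
  refine hN g _ fun ω i hi => hζ g (hI.mem_toFinset.2 hg) ω i (hi.trans_le ?_)
  exact Finset.le_sup (f := N) (hI.mem_toFinset.2 hg)

end CantorDynamics

namespace CantorDynamics

/-- A closed invariant set without isolated points in a totally disconnected compact `G`-space is
the image of an equivariant embedding of an action on the Cantor space. -/
theorem exists_cantorAction_of_isClosed {G E : Type*} [Group G] [TopologicalSpace E]
    [CompactSpace E] [T2Space E] [TotallyDisconnectedSpace E] [SecondCountableTopology E]
    [MulAction G E] [ContinuousConstSMul G E] (Z : Set E) (hZ : IsClosed Z) (hne : Z.Nonempty)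
    (hinv : ∀ (g : G), ∀ z ∈ Z, g • z ∈ Z)
    (hperf : ∀ z ∈ Z, ∀ U, IsOpen U → z ∈ U → ∃ w ∈ Z, w ∈ U ∧ w ≠ z) :
    ∃ (π : Cantor → E) (η : CantorAction G), Topology.IsEmbedding π ∧ Set.range π = Z ∧
      ∀ g ω, π (η g ω) = g • π ω := by
  let S : SubMulAction G E := ⟨Z, fun g {z} hz => hinv g z hz⟩
  have : CompactSpace S := isCompact_iff_compactSpace.1 hZ.isCompact
  have : Nonempty S := hne.to_subtype
  have : SecondCountableTopology S := TopologicalSpace.Subtype.secondCountableTopology Z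
  have : ContinuousConstSMul G S :=
    ⟨fun g => Continuous.subtype_mk (continuous_subtype_val.const_smul g) _⟩
  obtain ⟨e, η, he⟩ := exists_cantorAction (G := G) (X := S) (by
    intro x hx
    obtain ⟨U, hU, hUx⟩ := isOpen_induced_iff.1 hx
    have hxU : (x : E) ∈ U := by
      have : x ∈ Subtype.val ⁻¹' U := hUx ▸ rfl
      exact this
    obtain ⟨w, hwZ, hwU, hwx⟩ := hperf x x.2 U hU hxU
    have : (⟨w, hwZ⟩ : S) ∈ Subtype.val ⁻¹' U := hwU
    rw [hUx] at this
    exact hwx (congrArg Subtype.val this))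
  refine ⟨fun ω => (e.symm ω : E), η, Topology.IsEmbedding.subtypeVal.comp e.symm.isEmbedding,
    ?_, fun g ω => ?_⟩
  · ext z
    constructor
    · rintro ⟨ω, rfl⟩
      exact (e.symm ω).2
    · intro hz
      exact ⟨e ⟨z, hz⟩, by simp⟩
  · have := he g (e.symm ω)
    rw [e.apply_symm_apply] at this
    simp [this]

theorem isTransitive_of_isEmbedding {G E : Type*} [Group G] [TopologicalSpace E] [MulAction G E]
    {π : Cantor → E} {η : CantorAction G} (hπ : Topology.IsEmbedding π)
    (heq : ∀ g ω, π (η g ω) = g • π ω)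
    (H : ∀ O₁ O₂ : Set E, IsOpen O₁ → IsOpen O₂ → (O₁ ∩ Set.range π).Nonempty →
      (O₂ ∩ Set.range π).Nonempty → ∃ g : G, ∃ z ∈ Set.range π, z ∈ O₁ ∧ g • z ∈ O₂) :
    IsTransitive η := by
  intro U V hU hUne hV hVne
  obtain ⟨O₁, hO₁, rfl⟩ := hπ.isInducing.isOpen_iff.1 hU
  obtain ⟨O₂, hO₂, rfl⟩ := hπ.isInducing.isOpen_iff.1 hV
  obtain ⟨u, hu⟩ := hUne
  obtain ⟨v, hv⟩ := hVne
  obtain ⟨g, _, ⟨ω, rfl⟩, h1, h2⟩ :=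
    H O₁ O₂ hO₁ hO₂ ⟨π u, hu, u, rfl⟩ ⟨π v, hv, v, rfl⟩
  refine ⟨g, η g ω, ⟨ω, h1, rfl⟩, ?_⟩
  rw [Set.mem_preimage, heq]
  exact h2

/-- Baire category: for each basic open set, the points whose orbit enters it form a dense open set.
-/
theorem IsTransitive.exists_dense_orbit {G : Type*} [Group G] [Countable G] {ξ : CantorAction G}
    (hξ : IsTransitive ξ) : ∃ x : Cantor, ∀ U : Set Cantor, IsOpen U → U.Nonempty →
      ∃ g : G, ξ g x ∈ U := by
  obtain ⟨b, hbc, hb0, hb⟩ := TopologicalSpace.exists_countable_basis Cantor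
  have : Countable b := hbc
  have hbne : ∀ U : b, (U : Set Cantor).Nonempty := fun U =>
    Set.nonempty_iff_ne_empty.2 fun h => hb0 (h ▸ U.2)
  have hd : Dense (⋂ U : b, ⋃ g : G, ξ g ⁻¹' U) := by
    refine dense_iInter_of_isOpen
      (fun U => isOpen_iUnion fun g => (hb.isOpen U.2).preimage (ξ g).continuous) fun U => ?_
    rw [dense_iff_inter_open]
    intro V hV hVne
    obtain ⟨g, _, ⟨y, hyV, rfl⟩, hyU⟩ := hξ V U hV hVne (hb.isOpen U.2) (hbne U)
    exact ⟨y, hyV, Set.mem_iUnion.2 ⟨g, hyU⟩⟩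
  obtain ⟨x, hx⟩ := hd.nonempty
  refine ⟨x, fun U hU hUne => ?_⟩
  obtain ⟨y, hy⟩ := hUne
  obtain ⟨V, hVb, _, hVU⟩ := hb.exists_subset_of_mem_open hy hU
  obtain ⟨g, hg⟩ := Set.mem_iUnion.1 (Set.mem_iInter.1 hx ⟨V, hVb⟩)
  exact ⟨g, hVU hg⟩

/-- After finitely many visits, `W` minus the visited points would still be open and non-empty, and
the orbit would have to enter it. -/
theorem infinite_visits {G : Type*} [Group G] {ξ : CantorAction G} {x : Cantor}
    (hx : ∀ U : Set Cantor, IsOpen U → U.Nonempty → ∃ g : G, ξ g x ∈ U) {W : Set Cantor}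
    (hW : IsOpen W) (hne : W.Nonempty) : {g : G | ξ g x ∈ W}.Infinite := by
  intro hfin
  have hfin' := hfin.image fun g => ξ g x
  obtain ⟨g, hg, hg'⟩ := hx (W \ ((fun g => ξ g x) '' {g : G | ξ g x ∈ W}))
    (hW.sdiff hfin'.isClosed) ((infinite_of_isOpen not_isOpen_singleton_pi hW hne).sdiff
      hfin').nonempty
  exact hg' ⟨g, hg, rfl⟩

theorem IsTransitive.infinite_returns {G : Type*} [Group G] [Countable G] {ξ : CantorAction G}
    (hξ : IsTransitive ξ) {W : Set Cantor} (hW : IsOpen W) (hne : W.Nonempty) :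
    {g : G | ∃ y ∈ W, ξ g y ∈ W}.Infinite := by
  obtain ⟨x, hx⟩ := hξ.exists_dense_orbit
  have hinf := infinite_visits hx hW hne
  obtain ⟨g₀, hg₀⟩ := hinf.nonempty
  refine (hinf.image (f := fun g => g * g₀⁻¹) (mul_left_injective _).injOn).mono ?_
  rintro _ ⟨g, hg, rfl⟩
  refine ⟨ξ g₀ x, hg₀, ?_⟩
  simpa [← Homeomorph.mul_apply, ← map_mul] using hg

end CantorDynamics

/-! ### The shift on colorings -/

/-- Colorings of a group, on which the group acts by right translation of the argument. -/
def Coloring (G A : Type*) : Type _ := G → A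

namespace Coloring

variable {G A : Type*}

instance [TopologicalSpace A] : TopologicalSpace (Coloring G A) :=
  inferInstanceAs (TopologicalSpace (G → A))

instance [TopologicalSpace A] [CompactSpace A] : CompactSpace (Coloring G A) :=
  inferInstanceAs (CompactSpace (G → A))

instance [TopologicalSpace A] [T2Space A] : T2Space (Coloring G A) :=
  inferInstanceAs (T2Space (G → A))

instance [TopologicalSpace A] [TotallyDisconnectedSpace A] :
    TotallyDisconnectedSpace (Coloring G A) :=
  inferInstanceAs (TotallyDisconnectedSpace (G → A))

instance [TopologicalSpace A] [SecondCountableTopology A] [Countable G] :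
    SecondCountableTopology (Coloring G A) :=
  inferInstanceAs (SecondCountableTopology (G → A))

instance [Group G] : MulAction G (Coloring G A) where
  smul g x := fun h => x (h * g)
  one_smul x := funext fun h => congrArg x (mul_one h)
  mul_smul a b x := funext fun h => congrArg x (mul_assoc h a b).symm

theorem smul_apply [Group G] (g h : G) (x : Coloring G A) : (g • x) h = x (h * g) := rfl

theorem continuous_eval [TopologicalSpace A] (h : G) :
    Continuous fun x : Coloring G A => x h :=
  continuous_apply (A := fun _ : G => A) h

instance [Group G] [TopologicalSpace A] : ContinuousConstSMul G (Coloring G A) :=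
  ⟨fun g => continuous_pi fun h => continuous_eval (h * g)⟩

theorem isOpen_setOf_eqOn [TopologicalSpace A] [DiscreteTopology A] (F : Finset G)
    (q : Coloring G A) : IsOpen {x : Coloring G A | ∀ f ∈ F, x f = q f} := by
  have : {x : Coloring G A | ∀ f ∈ F, x f = q f} =
      ⋂ f ∈ F, (fun x : Coloring G A => x f) ⁻¹' {q f} := by
    ext x
    simp
  rw [this]
  exact isOpen_biInter_finset fun f _ => (isOpen_discrete _).preimage (continuous_eval f)

/-- The full shift on two symbols is mixing. -/
theorem exists_smul_mem [Group G] {W₁ W₂ : Set (Coloring G Bool)} (h₁ : IsOpen W₁)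
    (h₂ : IsOpen W₂) (n₁ : W₁.Nonempty) (n₂ : W₂.Nonempty) :
    {g : G | ¬ ∃ y ∈ W₁, g • y ∈ W₂}.Finite := by
  classical
  obtain ⟨y₁, hy₁⟩ := n₁
  obtain ⟨y₂, hy₂⟩ := n₂
  obtain ⟨I₁, u₁, hu₁, hs₁⟩ := isOpen_pi_iff.1 h₁ y₁ hy₁
  obtain ⟨I₂, u₂, hu₂, hs₂⟩ := isOpen_pi_iff.1 h₂ y₂ hy₂
  -- Outside `I₂⁻¹ * I₁` the windows `I₁` and `I₂ * g` are disjoint, so both patterns can be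
  -- prescribed at once.
  refine ((I₂⁻¹ * I₁).finite_toSet).subset fun g hg => ?_
  by_contra hgT
  refine hg ⟨fun k => if k ∈ I₁ then y₁ k else y₂ (k * g⁻¹), hs₁ ?_, hs₂ ?_⟩
  · intro k hk
    have hk' : k ∈ I₁ := hk
    simp only [if_pos hk']
    exact (hu₁ k hk').2
  · intro k hk
    have hk' : k * g ∉ I₁ := fun h => hgT
      (Finset.mem_mul.2 ⟨k⁻¹, Finset.inv_mem_inv hk, k * g, h, by group⟩)
    change (if k * g ∈ I₁ then y₁ (k * g) else y₂ (k * g * g⁻¹)) ∈ u₂ k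
    rw [if_neg hk', mul_inv_cancel_right]
    exact (hu₂ k hk).2

end Coloring

/-! ### Isolable subgroups as an obstruction to dense conjugacy classes -/

/-- A subgroup `A` is isolable if there is a right-`A`-invariant coloring `c` of the group by
finitely many colors and a finite window such that every coloring all of whose patterns occur in
`c` and which has color `c 1` at `1` has this color exactly at the elements of `A`. -/
def Subgroup.Isolable {G : Type*} [Group G] (A : Subgroup G) : Prop :=
  ∃ (S : Type) (_ : Finite S) (c : G → S) (F : Finset G), (∀ g, ∀ a ∈ A, c (g * a) = c g) ∧
    ∀ y : G → S, (∀ g, ∃ h, ∀ f ∈ F, y (f * g) = c (f * h)) → y 1 = c 1 →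
      ∀ g, y g = c 1 ↔ g ∈ A

namespace CantorDynamics

/-- The action lives on the orbit closure of `c` times the full 2-shift; the second factor removes
isolated points. Since `A` fixes `c`, all the infinitely many `g₂ * a * g₁⁻¹` carry `g₁ • c` to `g₂
• c`, and mixing of the full shift lets one of them work in the second factor too. -/
theorem exists_transitive_of_coloring {G S : Type*} [Group G] [Countable G] [Finite S]
    [TopologicalSpace S] [DiscreteTopology S] (A : Subgroup G) [Infinite A]
    (c : Coloring G S) (hc : ∀ g, ∀ a ∈ A, c (g * a) = c g) :
    ∃ (η : CantorAction G) (p : Cantor → Coloring G S), IsTransitive η ∧ Continuous p ∧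
      (∀ g ω, p (η g ω) = g • p ω) ∧ Set.range p = closure (MulAction.orbit G c) := by
  classical
  have hA : Infinite G := Infinite.of_injective _ A.subtype_injective
  let E := Coloring G S × Coloring G Bool
  let Z : Set E := closure (MulAction.orbit G c) ×ˢ Set.univ
  have hcZ : ∀ (g : G) (y : Coloring G Bool), ((g • c, y) : E) ∈ Z := fun g y =>
    ⟨subset_closure ⟨g, rfl⟩, trivial⟩
  obtain ⟨π, η, hπ, hrange, heq⟩ := exists_cantorAction_of_isClosed (G := G) Z
    (isClosed_closure.prod isClosed_univ) ⟨_, hcZ 1 fun _ => true⟩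
    (by
      rintro g ⟨x, y⟩ ⟨hx, -⟩
      refine ⟨map_mem_closure (f := fun x : Coloring G S => g • x)
        (continuous_const_smul g) hx ?_, trivial⟩
      rintro _ ⟨h, rfl⟩
      exact ⟨g * h, mul_smul g h c⟩)
    (by
      rintro ⟨x, y⟩ ⟨hx, -⟩ U hU hxy
      by_contra! hcon
      refine not_isOpen_singleton_pi (ι := G) y ?_
      have : ({y} : Set (Coloring G Bool)) = (fun w : Coloring G Bool => (x, w)) ⁻¹' U := by
        ext w
        refine ⟨fun hw => ?_, fun hw => ?_⟩
        · rw [Set.mem_singleton_iff.1 hw]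
          exact hxy
        · exact congrArg Prod.snd (hcon (x, w) ⟨hx, trivial⟩ hw)
      have hopen : IsOpen ((fun w : Coloring G Bool => (x, w)) ⁻¹' U) :=
        hU.preimage (by fun_prop)
      exact this ▸ hopen)
  have hdense : ∀ O : Set E, IsOpen O → (O ∩ Set.range π).Nonempty →
      ∃ (g : G) (W : Set (Coloring G Bool)), IsOpen W ∧ W.Nonempty ∧
        ∀ w ∈ W, (g • c, w) ∈ O := by
    rintro O hO ⟨⟨x, y⟩, hxy, hr⟩
    rw [hrange] at hr
    obtain ⟨V, W, hV, hW, hxV, hyW, hsub⟩ := isOpen_prod_iff.1 hO x y hxy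
    obtain ⟨_, hv, g, rfl⟩ := mem_closure_iff.1 hr.1 V hV hxV
    exact ⟨g, W, hW, ⟨y, hyW⟩, fun w hw => hsub ⟨hv, hw⟩⟩
  refine ⟨η, fun ω => (π ω).1, ?_, continuous_fst.comp hπ.continuous, fun g ω => ?_, ?_⟩
  · refine isTransitive_of_isEmbedding hπ heq fun O₁ O₂ hO₁ hO₂ hn₁ hn₂ => ?_
    obtain ⟨g₁, W₁, hW₁, hne₁, h₁⟩ := hdense O₁ hO₁ hn₁
    obtain ⟨g₂, W₂, hW₂, hne₂, h₂⟩ := hdense O₂ hO₂ hn₂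
    have hfin := Coloring.exists_smul_mem hW₁ hW₂ hne₁ hne₂
    have hinj : Function.Injective fun a : A => g₂ * a * g₁⁻¹ := fun a b hab => by
      simpa using hab
    obtain ⟨_, ⟨a, rfl⟩, ha⟩ := (Set.infinite_range_of_injective hinj).exists_notMem_finite hfin
    obtain ⟨y, hy₁, hy₂⟩ := not_not.1 ha
    refine ⟨g₂ * a * g₁⁻¹, (g₁ • c, y), hrange ▸ hcZ g₁ y, h₁ y hy₁, ?_⟩
    have hac : (a : G) • c = c := funext fun h => hc h a a.2
    have : (g₂ * a * g₁⁻¹) • ((g₁ • c, y) : E) = (g₂ • c, (g₂ * a * g₁⁻¹) • y) := by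
      rw [Prod.smul_mk, mul_smul, inv_smul_smul, mul_smul, hac]
    rw [this]
    exact h₂ _ hy₂
  · exact congrArg Prod.fst (heq g ω)
  · change Set.range (Prod.fst ∘ π) = _
    rw [Set.range_comp, hrange, Set.fst_image_prod _
      (⟨fun _ => true, Set.mem_univ _⟩ : (Set.univ : Set (Coloring G Bool)).Nonempty)]

/-- A conjugate of `ξ` close to the action built from `c` moves `P`-values over the window `F` as
that action does. So all its itineraries have only `F`-patterns of `c`, and isolability confines the
returns to `P = c 1` to `A`. -/
theorem exists_isOpen_returns_subset {G : Type*} [Group G] [Countable G] {ξ : CantorAction G}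
    (hξ : Dense {η : transitiveActions G | (η : CantorAction G) ∈ conjClass ξ})
    {A : Subgroup G} [Infinite A] (hA : A.Isolable) :
    ∃ U : Set Cantor, IsOpen U ∧ U.Nonempty ∧ ∀ g, ∀ ω ∈ U, ξ g ω ∈ U → g ∈ A := by
  obtain ⟨S, _, c, F, hc, hforce⟩ := hA
  change Coloring G S at c
  let : TopologicalSpace S := ⊥
  have : DiscreteTopology S := ⟨rfl⟩
  obtain ⟨η, p, hη, hp, heq, hrange⟩ := exists_transitive_of_coloring A c hc
  let P : Cantor → S := fun ω => p ω 1
  have hP : Continuous P := (Coloring.continuous_eval 1).comp hp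
  have hnhds := eventually_eq_of_continuous η F hP
  have hnhds' := continuous_subtype_val.continuousAt (x := (⟨η, hη⟩ : transitiveActions G)) hnhds
  obtain ⟨⟨ζ, hζ⟩, hζη, f, hf⟩ := mem_closure_iff_nhds.1 (hξ ⟨η, hη⟩) _ hnhds'
  simp only at hf
  subst hf
  have hmain : ∀ g ω, P ω = c 1 → P (conjAction f ξ g ω) = c 1 → g ∈ A := by
    intro g ω h1 h2
    refine (hforce (fun k => P (conjAction f ξ k ω)) (fun k => ?_) (by simpa using h1) g).1 h2
    have hmem : p (conjAction f ξ k ω) ∈ closure (MulAction.orbit G c) := hrange ▸ ⟨_, rfl⟩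
    obtain ⟨_, hx, h, rfl⟩ := mem_closure_iff.1 hmem _ (Coloring.isOpen_setOf_eqOn F _)
      fun _ _ => rfl
    refine ⟨h, fun a ha => ?_⟩
    calc P (conjAction f ξ (a * k) ω) = P (conjAction f ξ a (conjAction f ξ k ω)) := by
          rw [map_mul, Homeomorph.mul_apply]
      _ = p (η a (conjAction f ξ k ω)) 1 := hζη a ha _
      _ = p (conjAction f ξ k ω) a := by rw [heq, Coloring.smul_apply, one_mul]
      _ = c (a * h) := (hx a ha).symm
  refine ⟨f ⁻¹' (P ⁻¹' {c 1}), ((isOpen_discrete _).preimage hP).preimage f.continuous, ?_, ?_⟩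
  · have : (c : Coloring G S) ∈ Set.range p := hrange ▸ subset_closure (MulAction.mem_orbit_self c)
    obtain ⟨ω, hω⟩ := this
    refine ⟨f.symm ω, ?_⟩
    simp [P, hω]
  · intro g ω h1 h2
    refine hmain g (f ω) h1 ?_
    have : conjAction f ξ g (f ω) = f (ξ g ω) := by
      simp [conjAction_apply]
    rw [this]
    exact h2

/-- Two infinite isolable subgroups whose conjugates have finite intersections obstruct the
existence of a dense conjugacy class. -/
theorem not_hasDenseConjClass {G : Type*} [Group G] [Countable G] {A B : Subgroup G}
    [Infinite A] [Infinite B] (hA : A.Isolable) (hB : B.Isolable)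
    (hAB : ∀ g : G, {h ∈ A | g * h * g⁻¹ ∈ B}.Finite) : ¬ HasDenseConjClass G := by
  rintro ⟨ξ, hξ, hdense⟩
  obtain ⟨U, hU, hUne, hUA⟩ := exists_isOpen_returns_subset hdense hA
  obtain ⟨V, hV, hVne, hVB⟩ := exists_isOpen_returns_subset hdense hB
  obtain ⟨g, _, ⟨u, hu, rfl⟩, huV⟩ := hξ U V hU hUne hV hVne
  refine (IsTransitive.infinite_returns hξ (W := U ∩ ξ g ⁻¹' V)
    (hU.inter (hV.preimage (ξ g).continuous)) ⟨u, hu, huV⟩) ((hAB g).subset ?_)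
  rintro h ⟨y, ⟨hyU, hyV⟩, hhU, hhV⟩
  refine ⟨hUA h y hyU hhU, hVB _ (ξ g y) hyV ?_⟩
  simpa using hhV

end CantorDynamics

/-! ### Constructions of isolable subgroups -/

namespace Subgroup

variable {G : Type*} [Group G]

/-- Frees the color set from the universe `Type` fixed in `Isolable`. -/
theorem Isolable.of_finite {A : Subgroup G} {S : Type*} [Finite S] (c : G → S) (F : Finset G)
    (hc : ∀ g, ∀ a ∈ A, c (g * a) = c g)
    (h : ∀ y : G → S, (∀ g, ∃ h, ∀ f ∈ F, y (f * g) = c (f * h)) → y 1 = c 1 →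
      ∀ g, y g = c 1 ↔ g ∈ A) : A.Isolable := by
  obtain ⟨n, ⟨e⟩⟩ := Finite.exists_equiv_fin S
  refine ⟨Fin n, inferInstance, e ∘ c, F, fun g a ha => congrArg e (hc g a ha), ?_⟩
  intro y hy hy1 g
  rw [← h (e.symm ∘ y) (fun g => ?_) (by simp [hy1]) g]
  · simp [Equiv.symm_apply_eq]
  · obtain ⟨k, hk⟩ := hy g
    exact ⟨k, fun f hf => by simp [hk f hf]⟩

/-- Isolability is transitive. In a coloring by pairs the first entry singles out `M`, and on `M`
the second entry singles out `A`. -/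
theorem Isolable.map_subtype {M : Subgroup G} (hM : M.Isolable) {A : Subgroup M}
    (hA : A.Isolable) : (A.map M.subtype).Isolable := by
  classical
  obtain ⟨S₂, _, c₂, F₂, hc₂, h₂⟩ := hM
  obtain ⟨S₁, _, c₁, F₁, hc₁, h₁⟩ := hA
  have hself : ∀ g, c₂ g = c₂ 1 ↔ g ∈ M := h₂ c₂ (fun g => ⟨g, fun _ _ => rfl⟩) rfl
  let d : G → S₁ := fun g => if h : g ∈ M then c₁ ⟨g, h⟩ else c₁ 1
  have hd : ∀ m : M, d m = c₁ m := fun m => by simp [d]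
  refine Isolable.of_finite (fun g => (c₂ g, d g)) (F₂ ∪ F₁.image Subtype.val ∪ {1}) ?_ ?_
  · rintro g _ ⟨a, ha, rfl⟩
    refine Prod.ext (hc₂ g a a.2) ?_
    by_cases hg : g ∈ M
    · exact (hd (⟨g, hg⟩ * a)).trans ((hc₁ _ a ha).trans (hd ⟨g, hg⟩).symm)
    · have hga : g * a ∉ M := fun h => hg ((M.mul_mem_cancel_right a.2).1 h)
      simp [d, hg, hga]
  · intro y hy hy1
    have hyM : ∀ g, (y g).1 = c₂ 1 ↔ g ∈ M := by
      refine h₂ (fun g => (y g).1) (fun g => ?_) (congrArg Prod.fst hy1)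
      obtain ⟨k, hk⟩ := hy g
      exact ⟨k, fun f hf => congrArg Prod.fst (hk f (by simp [hf]))⟩
    have hyA : ∀ m : M, (y m).2 = c₁ 1 ↔ m ∈ A := by
      refine h₁ (fun m => (y m).2) (fun m => ?_) ((congrArg Prod.snd hy1).trans (hd 1))
      obtain ⟨k, hk⟩ := hy m
      -- With `1` in the window, the first color forces the matching center `k` into `M`, where `d`
      -- is `c₁`.
      have hk1 := hk 1 (by simp)
      rw [one_mul, one_mul] at hk1
      have hkM : k ∈ M := (hself k).1
        ((congrArg Prod.fst hk1).symm.trans ((hyM m).2 m.2))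
      refine ⟨⟨k, hkM⟩, fun f hf => ?_⟩
      have := congrArg Prod.snd (hk f (by
        simp only [Finset.mem_union, Finset.mem_image]
        exact Or.inl (Or.inr ⟨f, hf, rfl⟩)))
      exact this.trans (hd (f * ⟨k, hkM⟩))
    intro g
    have hd1 : d 1 = c₁ 1 := hd 1
    rw [Prod.ext_iff, hyM]
    simp only [hd1]
    constructor
    · rintro ⟨hg, hg2⟩
      exact ⟨⟨g, hg⟩, (hyA ⟨g, hg⟩).1 hg2, rfl⟩
    · rintro ⟨a, ha, rfl⟩
      exact ⟨a.2, (hyA a).2 ha⟩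

/-- Color by cosets. A window of generators forces `y (f * g) = f • y g`, so `y 1` determines `y`.
-/
theorem isolable_of_finiteIndex [Group.FG G] (M : Subgroup G) [M.FiniteIndex] : M.Isolable := by
  classical
  obtain ⟨T, hT⟩ := Group.fg_def.1 ‹Group.FG G›
  refine Isolable.of_finite (fun g => (g : G ⧸ M)) (T ∪ {1}) ?_ ?_
  · intro g a ha
    exact QuotientGroup.eq.2 (by simpa using ha)
  · intro y hy hy1
    have key : ∀ f g : G, y (f * g) = f • y g := by
      intro f
      have hf : f ∈ closure (T : Set G) := hT ▸ mem_top f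
      induction hf using closure_induction with
      | mem f hf =>
        intro g
        obtain ⟨h, hh⟩ := hy g
        have h1 := hh 1 (by simp)
        rw [one_mul, one_mul] at h1
        rw [hh f (by simp [Finset.mem_coe.1 hf]), h1]
        rfl
      | one => intro g; simp
      | mul a b _ _ iha ihb => intro g; rw [mul_assoc, iha, ihb, mul_smul]
      | inv a _ iha =>
        intro g
        rw [eq_inv_smul_iff, ← iha, mul_inv_cancel_left]
    intro g
    have := key g 1
    rw [mul_one, hy1] at this
    rw [this]
    change ((g * 1 : G) : G ⧸ M) = ((1 : G) : G ⧸ M) ↔ _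
    rw [mul_one, eq_comm, QuotientGroup.eq]
    simp

/-- Pull the coloring back from the quotient. Generators of `N` in the window force `y` to be
`N`-invariant, so `y` descends to `G ⧸ N`. -/
theorem isolable_of_quotient {N : Subgroup G} [N.Normal] (hN : N.FG)
    (h : (⊥ : Subgroup (G ⧸ N)).Isolable) : N.Isolable := by
  classical
  obtain ⟨T, hT⟩ := hN
  obtain ⟨S, _, c, F, -, hforce⟩ := h
  refine Isolable.of_finite (fun g => c g) (T ∪ F.image Quotient.out ∪ {1}) ?_ ?_
  · intro g a ha
    rw [(QuotientGroup.eq.2 (by simpa using ha) : ((g * a : G) : G ⧸ N) = g)]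
  · intro y hy hy1
    have hleft : ∀ n ∈ N, ∀ g, y (n * g) = y g := by
      intro n hn
      rw [← hT] at hn
      induction hn using closure_induction with
      | mem n hn =>
        intro g
        obtain ⟨h, hh⟩ := hy g
        have h1 := hh 1 (by simp)
        rw [one_mul, one_mul] at h1
        rw [hh n (by simp [Finset.mem_coe.1 hn]), h1]
        have hnN : n ∈ N := hT ▸ subset_closure hn
        have : ((n * h : G) : G ⧸ N) = h := by
          rw [QuotientGroup.mk_mul, (QuotientGroup.eq_one_iff n).2 hnN, one_mul]
        rw [this]
      | one => intro g; simp
      | mul a b _ _ iha ihb => intro g; rw [mul_assoc, iha, ihb]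
      | inv a _ iha =>
        intro g
        rw [← iha, mul_inv_cancel_left]
    have hquot : ∀ a b : G, (a : G ⧸ N) = b → y a = y b := by
      intro a b hab
      have : a * b⁻¹ ∈ N := by
        rw [← QuotientGroup.eq_one_iff, QuotientGroup.mk_mul, hab, ← QuotientGroup.mk_mul]
        simp
      simpa using hleft _ this b
    have hmain := hforce (fun q => y q.out) (fun q => by
      obtain ⟨h, hh⟩ := hy q.out
      refine ⟨h, fun f hf => ?_⟩
      have := hh f.out (by
        simp only [Finset.mem_union, Finset.mem_image]
        exact Or.inl (Or.inr ⟨f, hf, rfl⟩))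
      rw [QuotientGroup.mk_mul, QuotientGroup.out_eq'] at this
      rw [← this]
      exact hquot _ _ (by simp)) ((hquot _ _ (by simp)).trans hy1)
    intro g
    have hg := hmain g
    rw [mem_bot, QuotientGroup.eq_one_iff] at hg
    rw [← hg, hquot g (Quotient.out (g : G ⧸ N)) (by simp)]
    rfl

/-- Color the integers by sign. Among adjacent pairs, `0` and `1` are followed only by `1`, while
`0` and `-1` are preceded only by `-1`; hence `0` occurs once. -/
theorem bot_isolable_of_zpow_bijective (t : G) (ht : Function.Bijective fun k : ℤ => t ^ k) :
    (⊥ : Subgroup G).Isolable := by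
  classical
  let e : ℤ ≃ G := Equiv.ofBijective _ ht
  have he : ∀ k, e k = t ^ k := fun k => rfl
  have hes : ∀ k : ℤ, e.symm (t ^ k) = k := fun k => by rw [← he, e.symm_apply_apply]
  refine Isolable.of_finite (fun g => SignType.sign (e.symm g)) {1, t} ?_ ?_
  · intro g a ha
    rw [mem_bot.1 ha, mul_one]
  · intro y hy hy1
    have h1 : e.symm 1 = 0 := by simpa using hes 0
    simp only [h1, sign_zero] at hy1 ⊢
    have step : ∀ k : ℤ, ∃ l : ℤ, y (t ^ k) = SignType.sign l ∧
        y (t ^ (k + 1)) = SignType.sign (l + 1) := by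
      intro k
      obtain ⟨h, hh⟩ := hy (t ^ k)
      obtain ⟨l, rfl⟩ := ht.2 h
      refine ⟨l, ?_, ?_⟩
      · simpa [hes] using hh 1 (by simp)
      · have := hh t (by simp)
        simp only [← zpow_one_add, hes] at this
        rwa [add_comm k, add_comm l]
    have hpos : ∀ n : ℕ, y (t ^ ((n : ℤ) + 1)) = 1 := by
      intro n
      induction n with
      | zero =>
        obtain ⟨l, hl, hl1⟩ := step 0
        rw [zpow_zero, hy1, eq_comm, sign_eq_zero_iff] at hl
        subst hl
        simpa using hl1
      | succ n ih =>
        obtain ⟨l, hl, hl1⟩ := step (n + 1)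
        rw [ih, eq_comm, sign_eq_one_iff] at hl
        push_cast
        rw [hl1, sign_eq_one_iff]
        omega
    have hneg : ∀ n : ℕ, y (t ^ (-(n : ℤ) - 1)) = -1 := by
      intro n
      induction n with
      | zero =>
        obtain ⟨l, hl, hl1⟩ := step (-1)
        rw [show (-1 : ℤ) + 1 = 0 by norm_num, zpow_zero, hy1, eq_comm, sign_eq_zero_iff] at hl1
        simp only [CharP.cast_eq_zero, neg_zero, zero_sub]
        rw [hl, sign_eq_neg_one_iff]
        omega
      | succ n ih =>
        obtain ⟨l, hl, hl1⟩ := step (-(n : ℤ) - 1 - 1)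
        rw [sub_add_cancel, ih, eq_comm, sign_eq_neg_one_iff] at hl1
        push_cast
        rw [show -((n : ℤ) + 1) - 1 = -(n : ℤ) - 1 - 1 by ring, hl, sign_eq_neg_one_iff]
        omega
    intro g
    obtain ⟨k, rfl⟩ := ht.2 g
    simp only [mem_bot]
    rcases lt_trichotomy k 0 with hk | rfl | hk
    · obtain ⟨n, rfl⟩ : ∃ n : ℕ, k = -(n : ℤ) - 1 := ⟨(-k - 1).toNat, by omega⟩
      rw [hneg]
      refine iff_of_false (by decide) fun h => hk.ne (ht.1 (h.trans (zpow_zero t).symm))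
    · simpa using hy1
    · obtain ⟨n, rfl⟩ : ∃ n : ℕ, k = (n : ℤ) + 1 := ⟨(k - 1).toNat, by omega⟩
      rw [hpos]
      refine iff_of_false (by decide) fun h => hk.ne' (ht.1 (h.trans (zpow_zero t).symm))

/-- A cyclic complement of a normal subgroup in which the trivial subgroup is isolable is
isolable. -/
theorem zpowers_isolable_of_ker (φ : G →* Multiplicative ℤ) (b : G) (hb : φ b ≠ 1)
    (hφ : ∀ g, φ g ∈ zpowers (φ b)) (h : (⊥ : Subgroup φ.ker).Isolable) :
    (zpowers b).Isolable := by
  classical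
  obtain ⟨S, _, c, F, -, hforce⟩ := h
  have hself : ∀ n, c n = c 1 ↔ n ∈ (⊥ : Subgroup φ.ker) :=
    hforce c (fun g => ⟨g, fun _ _ => rfl⟩) rfl
  choose k hk using fun g => mem_zpowers_iff.1 (hφ g)
  have hinj : ∀ i j : ℤ, φ b ^ i = φ b ^ j → i = j := by
    intro i j hij
    have hb' : Multiplicative.toAdd (φ b) ≠ 0 := hb
    have := congrArg Multiplicative.toAdd hij
    rw [toAdd_zpow, toAdd_zpow, smul_eq_mul, smul_eq_mul] at this
    exact mul_right_cancel₀ hb' this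
  -- Each `g` is uniquely a kernel element `r g` times a power of `b`, and the coloring is `c ∘ r`.
  let r : G → φ.ker := fun g => ⟨g * (b ^ k g)⁻¹, by
    rw [MonoidHom.mem_ker, map_mul, map_inv, map_zpow, hk, mul_inv_cancel]⟩
  have hr : ∀ g, (r g : G) * b ^ k g = g := fun g => inv_mul_cancel_right _ _
  have hrmul : ∀ (n : φ.ker) (j : ℤ) (g : G), r (n * g * b ^ j) = n * r g := by
    intro n j g
    have hkk : k (n * g * b ^ j) = k g + j := by
      refine hinj _ _ ?_
      rw [hk, zpow_add, hk, map_mul, map_mul, map_zpow, n.2, one_mul]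
    apply Subtype.ext
    change (n : G) * g * b ^ j * (b ^ k (n * g * b ^ j))⁻¹ = n * (g * (b ^ k g)⁻¹)
    rw [hkk, add_comm, zpow_add]
    group
  have hr1 : ∀ g, r g = 1 ↔ g ∈ zpowers b := by
    intro g
    constructor
    · intro h
      have := hr g
      rw [h, coe_one, one_mul] at this
      exact ⟨k g, this⟩
    · rintro ⟨j, rfl⟩
      have hone : r 1 = 1 := by
        have hk1 : k 1 = 0 := hinj _ _ (by rw [hk, map_one, zpow_zero])
        apply Subtype.ext
        change (1 : G) * (b ^ k 1)⁻¹ = 1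
        simp [hk1]
      have := hrmul 1 j 1
      simpa [hone] using this
  have hone : r 1 = 1 := (hr1 1).2 (one_mem _)
  have hc : ∀ g, c (r g) = c 1 ↔ g ∈ zpowers b := fun g => by rw [hself, mem_bot, hr1]
  refine Isolable.of_finite (fun g => c (r g)) (F.image Subtype.val ∪ {1, b, b⁻¹}) ?_ ?_
  · rintro g _ ⟨j, rfl⟩
    have := hrmul 1 j g
    rw [coe_one, one_mul, one_mul] at this
    simp only [this]
  · intro y hy hy1
    simp only [hone] at hy1 ⊢
    -- The color `c 1` spreads along the powers of `b`. Around each `b ^ j`, the coset of the kernel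
    -- is then a copy of `φ.ker` on which `hforce` applies.
    have hstep : ∀ f ∈ ({b, b⁻¹} : Finset G), ∀ g, y g = c 1 → y (f * g) = c 1 := by
      intro f hf g hg
      obtain ⟨h, hh⟩ := hy g
      have h1 := hh 1 (by simp)
      rw [one_mul, one_mul, hg, eq_comm, hc] at h1
      rw [hh f (Finset.mem_union_right _ (Finset.mem_insert_of_mem hf)), hc]
      refine mul_mem ?_ h1
      simp only [Finset.mem_insert, Finset.mem_singleton] at hf
      rcases hf with rfl | rfl
      · exact mem_zpowers _
      · exact inv_mem (mem_zpowers _)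
    have hpow : ∀ j : ℤ, y (b ^ j) = c 1 := by
      intro j
      induction j using Int.induction_on with
      | zero => simpa using hy1
      | succ j ih =>
        have := hstep b (by simp) _ ih
        rwa [← zpow_one_add, add_comm] at this
      | pred j ih =>
        have := hstep b⁻¹ (by simp) _ ih
        rwa [← zpow_neg_one, ← zpow_add, add_comm, ← sub_eq_add_neg] at this
    have hcoset : ∀ (j : ℤ) (n : φ.ker), y (n * b ^ j) = c 1 ↔ n ∈ (⊥ : Subgroup φ.ker) := by
      intro j
      refine hforce (fun n => y (n * b ^ j)) (fun n => ?_) (by simpa using hpow j)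
      obtain ⟨h, hh⟩ := hy (n * b ^ j)
      refine ⟨r h, fun f hf => ?_⟩
      have h1 := hh f (by
        simp only [Finset.mem_union, Finset.mem_image]
        exact Or.inl ⟨f, hf, rfl⟩)
      have h2 := hrmul f 0 h
      rw [zpow_zero, mul_one] at h2
      rw [h2, ← mul_assoc] at h1
      exact h1
    intro g
    rw [← hr1, ← mem_bot, ← hcoset (k g) (r g), hr]

end Subgroup

-- Polycyclic groups

universe u

theorem Group.fg_of_subgroup_fg {G : Type*} [Group G] (N : Subgroup G) (hN : N.FG) (R : Set G)
    (hR : R.Finite) (h : ∀ g, ∃ r ∈ Subgroup.closure R, r⁻¹ * g ∈ N) : Group.FG G := by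
  obtain ⟨T, hT⟩ := hN
  refine Group.fg_iff.2 ⟨T ∪ R, ?_, T.finite_toSet.union hR⟩
  rw [eq_top_iff]
  intro g _
  obtain ⟨r, hr, hg⟩ := h g
  rw [← hT] at hg
  rw [← mul_inv_cancel_left r g]
  exact mul_mem (Subgroup.closure_mono Set.subset_union_right hr)
    (Subgroup.closure_mono Set.subset_union_left hg)

theorem Group.fg_of_finiteIndex_fg {G : Type*} [Group G] (N : Subgroup G) [N.FiniteIndex]
    (hN : N.FG) : Group.FG G := by
  have hfin : (Set.range fun q : G ⧸ N => q.out).Finite := Set.finite_range _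
  refine Group.fg_of_subgroup_fg N hN _ hfin fun g =>
    ⟨(g : G ⧸ N).out, Subgroup.subset_closure ⟨_, rfl⟩, ?_⟩
  rw [← QuotientGroup.eq]
  simp

theorem countable_of_fg (G : Type*) [Group G] [Group.FG G] : Countable G := by
  obtain ⟨S, hS⟩ := Group.fg_def.1 ‹Group.FG G›
  have : Function.Surjective (FreeGroup.lift (fun s : S => (s : G))) := by
    rw [← MonoidHom.range_eq_top, FreeGroup.range_lift_eq_closure]
    simpa using hS
  exact this.countable

/-- Groups built from the trivial group by finitely many extensions with cyclic quotient. -/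
inductive IsPolyCyc : (G : Type u) → [Group G] → Prop
  | trivial (G : Type u) [Group G] : Subsingleton G → IsPolyCyc G
  | extension (G : Type u) [Group G] (N : Subgroup G) [N.Normal] :
      IsPolyCyc N → IsCyclic (G ⧸ N) → IsPolyCyc G

namespace IsPolyCyc

theorem of_surjective {G : Type u} [Group G] (hG : IsPolyCyc G) :
    ∀ {H : Type u} [Group H] (f : G →* H), Function.Surjective f → IsPolyCyc H := by
  induction hG with
  | trivial G hG => exact fun f hf => .trivial _ hf.subsingleton
  | extension G N _ hcyc ih =>
    intro H _ f hf
    have : (N.map f).Normal := Subgroup.Normal.map inferInstance f hf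
    refine .extension H (N.map f) (ih (f.subgroupMap N) (f.subgroupMap_surjective N)) ?_
    refine isCyclic_of_surjective (QuotientGroup.map N (N.map f) f (Subgroup.le_comap_map f N)) ?_
    exact QuotientGroup.map_surjective_of_surjective _ _ _ (by
      exact (QuotientGroup.mk_surjective).comp hf) _

theorem of_injective {G : Type u} [Group G] (hG : IsPolyCyc G) :
    ∀ {H : Type u} [Group H] (f : H →* G), Function.Injective f → IsPolyCyc H := by
  induction hG with
  | trivial G hG => exact fun f hf => .trivial _ hf.subsingleton
  | extension G N _ hcyc ih =>
    intro H _ f hf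
    refine .extension H (N.comap f) (ih (f.subgroupComap N) ?_) ?_
    · intro a b hab
      exact Subtype.ext (hf (congrArg Subtype.val hab))
    · refine isCyclic_of_injective (QuotientGroup.map (N.comap f) N f le_rfl) ?_
      rw [← MonoidHom.ker_eq_bot_iff, QuotientGroup.ker_map]
      simp

theorem subgroup {G : Type u} [Group G] (hG : IsPolyCyc G) (H : Subgroup G) : IsPolyCyc H :=
  hG.of_injective H.subtype H.subtype_injective

theorem fg {G : Type u} [Group G] (hG : IsPolyCyc G) : Group.FG G := by
  induction hG with
  | trivial G hG => infer_instance
  | extension G N _ hcyc ih =>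
    obtain ⟨q, hq⟩ := hcyc.exists_generator
    obtain ⟨t, rfl⟩ := QuotientGroup.mk_surjective q
    refine Group.fg_of_subgroup_fg N ((Group.fg_iff_subgroup_fg N).1 ih) {t}
      (Set.finite_singleton _) fun g => ?_
    obtain ⟨k, hk⟩ := hq g
    refine ⟨t ^ k, zpow_mem (Subgroup.subset_closure (Set.mem_singleton t)) k, ?_⟩
    rw [← QuotientGroup.eq]
    exact hk

theorem subgroup_fg {G : Type u} [Group G] (hG : IsPolyCyc G) (H : Subgroup G) : H.FG :=
  (Group.fg_iff_subgroup_fg H).1 (hG.subgroup H).fg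

/-- `N` is isolable since its quotient is finite or infinite cyclic, and the trivial subgroup is
isolable in `N` by induction. -/
theorem bot_isolable {G : Type u} [Group G] (hG : IsPolyCyc G) :
    (⊥ : Subgroup G).Isolable := by
  induction hG with
  | trivial G hG =>
    exact Subgroup.isolable_of_finiteIndex _
  | extension G N hN hcyc ih =>
    have hG := IsPolyCyc.extension G N hN hcyc
    have := hG.fg
    have hq : (⊥ : Subgroup (G ⧸ N)).Isolable := by
      rcases finite_or_infinite (G ⧸ N) with h | h
      · exact Subgroup.isolable_of_finiteIndex _
      · obtain ⟨t, ht⟩ := hcyc.exists_generator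
        refine Subgroup.bot_isolable_of_zpow_bijective t ⟨?_, fun g => ht g⟩
        rw [injective_zpow_iff_not_isOfFinOrder, ← orderOf_eq_zero_iff]
        exact Infinite.orderOf_eq_zero_of_forall_mem_zpowers ht
    have := (Subgroup.isolable_of_quotient (hG.subgroup_fg N) hq).map_subtype ih
    simpa using this

/-- Descend through the finite cyclic quotients of the series to the first infinite one. -/
theorem exists_finiteIndex_hom {G : Type u} [Group G] (hG : IsPolyCyc G) :
    Infinite G → ∃ (M : Subgroup G) (φ : M →* Multiplicative ℤ), M.FiniteIndex ∧ φ ≠ 1 := by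
  induction hG with
  | trivial G hG => exact fun h => (not_finite G).elim
  | extension G N hN hcyc ih =>
    intro hinf
    rcases finite_or_infinite (G ⧸ N) with h | h
    · have hNfi : N.FiniteIndex := Subgroup.finiteIndex_of_finite_quotient
      have hNinf : Infinite N := by
        by_contra hcon
        rw [not_infinite_iff_finite] at hcon
        have : Finite G := (Subgroup.finite_iff_finite_and_finiteIndex N).2 ⟨hcon, hNfi⟩
        exact not_finite G
      obtain ⟨M, φ, hM, hφ⟩ := ih hNinf
      let e : M ≃* M.map N.subtype := M.equivMapOfInjective _ N.subtype_injective
      refine ⟨M.map N.subtype, φ.comp e.symm.toMonoidHom, ?_, ?_⟩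
      · exact ⟨by
          rw [Subgroup.index_map_subtype]
          exact mul_ne_zero hM.index_ne_zero hNfi.index_ne_zero⟩
      · intro h
        refine hφ (MonoidHom.ext fun m => ?_)
        simpa using DFunLike.congr_fun h (e m)
    · let ψ : G →* Multiplicative ℤ :=
        (intCyclicMulEquiv (G := G ⧸ N)).symm.toMonoidHom.comp (QuotientGroup.mk' N)
      have hψ : Function.Surjective ψ :=
        (intCyclicMulEquiv (G := G ⧸ N)).symm.surjective.comp (QuotientGroup.mk'_surjective N)
      refine ⟨⊤, ψ.comp (⊤ : Subgroup G).subtype, inferInstance, fun h => ?_⟩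
      obtain ⟨g, hg⟩ := hψ (Multiplicative.ofAdd 1)
      have := DFunLike.congr_fun h ⟨g, Subgroup.mem_top g⟩
      simp [hg] at this

end IsPolyCyc

theorem IsPolycyclic.isPolyCyc {G : Type u} [Group G] (h : IsPolycyclic G) : IsPolyCyc G := by
  obtain ⟨n, H, h0, hn, hH⟩ := h
  have key : ∀ i ≤ n, IsPolyCyc (H i) := by
    intro i
    induction i with
    | zero =>
      intro _
      rw [h0]
      exact .trivial _ inferInstance
    | succ i ih =>
      intro hi
      obtain ⟨hle, hnorm, hcyc⟩ := hH i hi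
      refine .extension _ ((H i).subgroupOf (H (i + 1))) ?_ hcyc
      exact (ih (by omega)).of_injective (Subgroup.subgroupOfEquivOfLe hle).toMonoidHom
        (Subgroup.subgroupOfEquivOfLe hle).injective
  exact (key n le_rfl).of_injective (Subgroup.topEquiv.symm.trans
    (MulEquiv.subgroupCongr hn).symm).toMonoidHom (MulEquiv.injective _)

open Subgroup

theorem IsVirtuallyPolycyclic.exists_normal_hom {G : Type u} [Group G] [Infinite G]
    (hG : IsVirtuallyPolycyclic G) : ∃ (M : Subgroup G) (φ : M →* Multiplicative ℤ), M.Normal ∧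
      M.FiniteIndex ∧ IsPolyCyc M ∧ φ ≠ 1 := by
  obtain ⟨P, hP, hPp⟩ := hG
  have hPc := hPp.isPolyCyc
  have hPinf : Infinite P := by
    by_contra hcon
    rw [not_infinite_iff_finite] at hcon
    have : Finite G := (Subgroup.finite_iff_finite_and_finiteIndex P).2 ⟨hcon, hP⟩
    exact not_finite G
  obtain ⟨M₀, φ₀, hM₀, hφ₀⟩ := hPc.exists_finiteIndex_hom hPinf
  let M₁ := M₀.map P.subtype
  have hM₁ : M₁.FiniteIndex := ⟨by
    rw [Subgroup.index_map_subtype]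
    exact mul_ne_zero hM₀.index_ne_zero hP.index_ne_zero⟩
  let e : M₀ ≃* M₁ := M₀.equivMapOfInjective _ P.subtype_injective
  let i : M₁.normalCore →* M₀ := e.symm.toMonoidHom.comp (inclusion M₁.normalCore_le)
  have hi : Function.Injective i :=
    e.symm.injective.comp (inclusion_injective M₁.normalCore_le)
  refine ⟨M₁.normalCore, φ₀.comp i, inferInstance, inferInstance,
    (hPc.subgroup M₀).of_injective i hi, fun h => hφ₀ (MonoidHom.ext fun m => ?_)⟩
  -- A power of each element lies in the normal core, and the integers are torsion-free, so `φ₀`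
  -- stays non-trivial there.
  obtain ⟨n, hn, -, hmem⟩ := Subgroup.exists_pow_mem_of_index_ne_zero
    (FiniteIndex.index_ne_zero (H := M₁.normalCore)) (e m : G)
  have h1 : i ⟨_, hmem⟩ = m ^ n := by
    change e.symm (inclusion M₁.normalCore_le ⟨_, hmem⟩) = m ^ n
    rw [MulEquiv.symm_apply_eq, map_pow]
    rfl
  have h2 : φ₀ (i ⟨_, hmem⟩) = 1 := DFunLike.congr_fun h _
  rw [h1, map_pow] at h2
  exact (pow_eq_one_iff_left hn.ne').1 h2

/-! ### Two isolable subgroups with finite mutual intersections -/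

section ZHom

variable {G : Type u} [Group G] {M : Subgroup G} (φ : M →* Multiplicative ℤ)
  {b : M}

theorem finiteIndex_comap_zpowers {H : Type*} [Group H] (φ : H →* Multiplicative ℤ) {b : H}
    (hb : φ b ≠ 1) : ((zpowers (φ b)).comap φ).FiniteIndex := by
  have h1 : (zpowers (φ b)).FiniteIndex := by
    refine ⟨?_⟩
    have : (AddSubgroup.zmultiples (Multiplicative.toAdd (φ b))).index ≠ 0 := by
      rw [Int.index_zmultiples]
      exact Int.natAbs_ne_zero.2 hb
    exact this
  have h2 : ((zpowers (φ b)).subgroupOf φ.range).FiniteIndex := inferInstance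
  exact ⟨by rw [index_comap]; exact h2.index_ne_zero⟩

/-- In the finite index subgroup `L`, the element `b` generates a complement of the kernel.
Isolability then climbs from `L` to `M` to `G`. -/
theorem zpowers_isolable [M.FiniteIndex] (hM : IsPolyCyc M) (hb : φ b ≠ 1) :
    (zpowers (b : G)).Isolable := by
  have hMfg := hM.fg
  have hG : Group.FG G := Group.fg_of_finiteIndex_fg M ((Group.fg_iff_subgroup_fg M).1 hMfg)
  let L := (zpowers (φ b)).comap φ
  have hL : L.FiniteIndex := finiteIndex_comap_zpowers φ hb
  let b' : L := ⟨b, mem_zpowers _⟩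
  have h1 : (zpowers b').Isolable :=
    zpowers_isolable_of_ker (φ.comp L.subtype) b' hb (fun g => g.2)
      ((hM.subgroup L).subgroup _).bot_isolable
  have h2 := (isolable_of_finiteIndex M).map_subtype ((isolable_of_finiteIndex L).map_subtype h1)
  rwa [MonoidHom.map_zpowers, MonoidHom.map_zpowers] at h2

theorem finiteIndex_zpowers_of_finite_ker [M.FiniteIndex] (hb : φ b ≠ 1) [Finite φ.ker] :
    (zpowers (b : G)).FiniteIndex := by
  let L := (zpowers (φ b)).comap φ
  have hL : L.FiniteIndex := finiteIndex_comap_zpowers φ hb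
  let b' : L := ⟨b, mem_zpowers _⟩
  have h1 : Finite (L ⧸ zpowers b') := by
    have hle : φ.ker ≤ L := fun x hx => by
      change φ x ∈ zpowers (φ b)
      rw [MonoidHom.mem_ker.1 hx]
      exact one_mem _
    refine Finite.of_surjective (fun k : φ.ker => (inclusion hle k : L ⧸ zpowers b')) ?_
    intro q
    obtain ⟨g, rfl⟩ := QuotientGroup.mk_surjective q
    obtain ⟨j, hj⟩ := mem_zpowers_iff.1 g.2
    refine ⟨⟨g * (b ^ j)⁻¹, ?_⟩, ?_⟩
    · rw [MonoidHom.mem_ker, map_mul, map_inv, map_zpow, hj, mul_inv_cancel]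
    · refine QuotientGroup.eq.2 ⟨j, ?_⟩
      apply Subtype.ext
      change (b : M) ^ j = (g * (b ^ j)⁻¹)⁻¹ * g
      group
  have h2 : (zpowers b').FiniteIndex := finiteIndex_of_finite_quotient
  have h3 : ((zpowers b').map L.subtype).FiniteIndex := ⟨by
    rw [index_map_subtype]
    exact mul_ne_zero h2.index_ne_zero hL.index_ne_zero⟩
  have h4 : (((zpowers b').map L.subtype).map M.subtype).FiniteIndex := ⟨by
    rw [index_map_subtype]
    exact mul_ne_zero h3.index_ne_zero (FiniteIndex.index_ne_zero (H := M))⟩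
  rwa [MonoidHom.map_zpowers, MonoidHom.map_zpowers] at h4

theorem injective_zpow_of_hom {H : Type*} [Group H] (φ : H →* Multiplicative ℤ) {b : H}
    (hb : φ b ≠ 1) : Function.Injective fun k : ℤ => b ^ k := by
  rw [injective_zpow_iff_not_isOfFinOrder]
  intro h
  obtain ⟨n, hn, hbn⟩ := isOfFinOrder_iff_pow_eq_one.1 h
  have := congrArg φ hbn
  rw [map_pow, map_one] at this
  exact hb ((pow_eq_one_iff_left hn.ne').1 this)

theorem infinite_zpowers_of_hom (hb : φ b ≠ 1) : Infinite (zpowers (b : G)) := by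
  have h := injective_zpow_of_hom φ hb
  refine Infinite.of_injective (fun k : ℤ => (⟨(b : G) ^ k, k, rfl⟩ : zpowers (b : G))) ?_
  intro i j hij
  refine h (Subtype.ext ?_)
  simpa using congrArg Subtype.val hij

variable (M) in
/-- The intersection of the kernels of all homomorphisms to the integers. -/
def zKernel : Subgroup M := ⨅ ψ : M →* Multiplicative ℤ, ψ.ker

theorem mem_zKernel {x : M} : x ∈ zKernel M ↔ ∀ ψ : M →* Multiplicative ℤ, ψ x = 1 := by
  simp [zKernel, mem_iInf, MonoidHom.mem_ker]

theorem zKernel_isolable [M.FiniteIndex] (hM : IsPolyCyc M) : ((zKernel M).map M.subtype).Isolable := by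
  have hMfg := hM.fg
  have hG : Group.FG G := Group.fg_of_finiteIndex_fg M ((Group.fg_iff_subgroup_fg M).1 hMfg)
  have hnorm : (zKernel M).Normal := normal_iInf_normal fun ψ => inferInstance
  exact (isolable_of_finiteIndex M).map_subtype
    (isolable_of_quotient (hM.subgroup_fg _)
      (hM.of_surjective (QuotientGroup.mk' (zKernel M))
        (QuotientGroup.mk'_surjective _)).bot_isolable)

end ZHom

/-- Otherwise, for two distinct exponents `n`, `m` the conjugators lie in one coset of `M`.
Homomorphisms to the integers ignore conjugation by `M`, so the images of `b * c ^ n` and `b * c ^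
m` under `(φ, χ)` are proportional to one vector. These are `(p, q + n * r)` and `(p, q + m * r)`
with `p` and `r` non-zero, a contradiction. -/
theorem exists_zpowers_disjoint {G : Type u} [Group G] {M : Subgroup G} [M.Normal]
    [M.FiniteIndex] (φ χ : M →* Multiplicative ℤ) {b c : M} (hφb : φ b ≠ 1) (hφc : φ c = 1)
    (hχc : χ c ≠ 1) :
    ∃ n : ℕ, ∀ (g : G) (i j : ℤ),
      g * (b * c ^ n : M) ^ i * g⁻¹ = ((b ^ j : M) : G) → i = 0 := by
  by_contra! hcon
  choose g i j hij hi using hcon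
  obtain ⟨n, m, hnm, hgnm⟩ := Finite.exists_ne_map_eq_of_infinite fun n => (g n : G ⧸ M)
  let σ : M ≃* M := MulAut.conjNormal (g m)
  have hconj : ∀ (k : ℕ), (g k : G ⧸ M) = g m → ∀ θ : M →* Multiplicative ℤ,
      i k * Multiplicative.toAdd (θ (b * c ^ k)) =
        j k * Multiplicative.toAdd (θ (σ.symm b)) := by
    intro k hk θ
    have hu : (g m)⁻¹ * g k ∈ M := QuotientGroup.eq.1 hk.symm
    let v : M := ⟨_, hu⟩
    have h1 : v * (b * c ^ k) ^ i k * v⁻¹ = σ.symm (b ^ j k) := by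
      rw [MulEquiv.eq_symm_apply]
      apply Subtype.ext
      rw [MulAut.conjNormal_apply, ← hij k]
      simp only [v, coe_mul, coe_inv, coe_pow, coe_zpow]
      group
    have h2 := congrArg (fun x => Multiplicative.toAdd (θ x)) h1
    simpa only [map_mul, map_inv, map_zpow, mul_inv_cancel_comm, toAdd_zpow, smul_eq_mul]
      using h2
  have h1 := hconj n hgnm φ
  have h2 := hconj m rfl φ
  have h3 := hconj n hgnm χ
  have h4 := hconj m rfl χ
  simp only [map_mul, map_pow, hφc, one_pow, mul_one, toAdd_mul, toAdd_pow, nsmul_eq_mul]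
    at h1 h2 h3 h4
  set p := Multiplicative.toAdd (φ b)
  set q := Multiplicative.toAdd (χ b)
  set r := Multiplicative.toAdd (χ c)
  have hp : p ≠ 0 := hφb
  have hr : r ≠ 0 := hχc
  set s := Multiplicative.toAdd (φ (σ.symm b))
  set t := Multiplicative.toAdd (χ (σ.symm b))
  have hs : s ≠ 0 := by
    intro hs
    rw [hs, mul_zero] at h1
    exact (mul_ne_zero (hi n) hp) h1
  have h5 : j n * i m = j m * i n := by
    refine mul_right_cancel₀ hs ?_
    linear_combination (-i m) * h1 + i n * h2
  have h6 : ((n : ℤ) - m) * (r * (i n * i m)) = 0 := by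
    linear_combination i m * h3 - i n * h4 + t * h5
  have h7 : ((n : ℤ) - m) ≠ 0 := sub_ne_zero.2 (by exact_mod_cast hnm)
  exact mul_ne_zero h7 (mul_ne_zero hr (mul_ne_zero (hi n) (hi m))) h6

theorem IsVirtuallyPolycyclic.exists_isolable_pair {G : Type u} [Group G] [Infinite G]
    (hG : IsVirtuallyPolycyclic G) (hcyc : ¬ IsVirtuallyCyclic G) :
    ∃ A B : Subgroup G, Infinite A ∧ Infinite B ∧ A.Isolable ∧ B.Isolable ∧
      ∀ g : G, {h ∈ A | g * h * g⁻¹ ∈ B}.Finite := by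
  obtain ⟨M, φ, hMn, hMfi, hM, hφ⟩ := hG.exists_normal_hom
  obtain ⟨b, hb⟩ : ∃ b, φ b ≠ 1 := by
    by_contra! h
    exact hφ (MonoidHom.ext h)
  rcases finite_or_infinite (zKernel M) with hK | hK
  -- With `zKernel M` finite, the infinite kernel of `φ` holds some `c` seen by another `χ`, and
  -- both subgroups can be taken cyclic.
  · have hker : Infinite φ.ker := by
      by_contra hcon
      rw [not_infinite_iff_finite] at hcon
      exact hcyc ⟨_, finiteIndex_zpowers_of_finite_ker φ hb, inferInstance⟩
    obtain ⟨c, hc, hcK⟩ := (Set.infinite_coe_iff.1 hker).exists_notMem_finite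
      (Set.finite_coe_iff.1 hK)
    obtain ⟨χ, hχ⟩ : ∃ χ : M →* Multiplicative ℤ, χ c ≠ 1 := by
      by_contra! h
      exact hcK (mem_zKernel.2 h)
    obtain ⟨n, hn⟩ := exists_zpowers_disjoint φ χ hb hc hχ
    have hbn : φ (b * c ^ n) ≠ 1 := by
      rwa [map_mul, map_pow, MonoidHom.mem_ker.1 hc, one_pow, mul_one]
    refine ⟨zpowers ((b * c ^ n : M) : G), zpowers (b : G), infinite_zpowers_of_hom φ hbn,
      infinite_zpowers_of_hom φ hb, zpowers_isolable φ hM hbn, zpowers_isolable φ hM hb,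
      fun g => (Set.finite_singleton 1).subset ?_⟩
    rintro _ ⟨⟨i, rfl⟩, j, hj⟩
    have := hn g i j (by simpa using hj.symm)
    simp [this]
  -- `zKernel M` is invariant under automorphisms of `M`, so its conjugates in `G` are killed by
  -- `φ`, unlike non-trivial powers of `b`.
  · have hinj : Function.Injective ((zKernel M).equivMapOfInjective _ M.subtype_injective) :=
      MulEquiv.injective _
    refine ⟨(zKernel M).map M.subtype, zpowers (b : G), Infinite.of_injective _ hinj,
      infinite_zpowers_of_hom φ hb, zKernel_isolable hM, zpowers_isolable φ hM hb,
      fun g => (Set.finite_singleton 1).subset ?_⟩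
    rintro _ ⟨⟨k, hk, rfl⟩, j, hj⟩
    have hconj : MulAut.conjNormal g k = b ^ j := by
      apply Subtype.ext
      rw [MulAut.conjNormal_apply]
      simpa using hj.symm
    have h1 : φ (MulAut.conjNormal g k) = 1 :=
      mem_zKernel.1 hk (φ.comp (MulAut.conjNormal g : M ≃* M).toMonoidHom)
    rw [hconj, map_zpow] at h1
    have hj0 : j = 0 := by
      have h2 := congrArg Multiplicative.toAdd h1
      rw [toAdd_zpow, smul_eq_mul, toAdd_one] at h2
      exact (mul_eq_zero.1 h2).resolve_right hb
    rw [hj0, zpow_zero] at hconj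
    have : k = 1 := (MulEquiv.map_eq_one_iff (MulAut.conjNormal g : M ≃* M)).1 hconj
    simp [this]

/-! ### Virtually cyclic groups: coordinates and periodic colorings -/

/-- An integer coordinate on a group with a distinguished element `t`: right multiplication by `t`
is the unit translation, and its bounded sets are finite. -/
structure IsCoordinate {G : Type*} [Group G] (t : G) (k : G → ℤ) : Prop where
  mul_zpow : ∀ g j, k (g * t ^ j) = k g + j
  finite : ∀ K : ℤ, {g | |k g| ≤ K}.Finite

theorem exists_isCoordinate {G : Type*} [Group G] {t : G}
    (ht : Function.Injective fun j : ℤ => t ^ j) [(zpowers t).FiniteIndex] :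
    ∃ k : G → ℤ, IsCoordinate t k := by
  have hout : ∀ g : G, ∃ j : ℤ, t ^ j = (g : G ⧸ zpowers t).out⁻¹ * g := fun g =>
    mem_zpowers_iff.1 (QuotientGroup.eq.1 (by simp))
  choose k hk using hout
  have hk' : ∀ g : G, (g : G ⧸ zpowers t).out * t ^ k g = g := fun g => by
    rw [hk, mul_inv_cancel_left]
  refine ⟨k, ⟨fun g j => ?_, fun K => ?_⟩⟩
  · refine ht ?_
    have : ((g * t ^ j : G) : G ⧸ zpowers t) = g := QuotientGroup.eq.2 (by simp)
    simp only [hk, zpow_add, this, mul_assoc]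
  · have hfin : (Set.univ ×ˢ Set.Icc (-K) K : Set ((G ⧸ zpowers t) × ℤ)).Finite :=
      Set.finite_univ.prod (Set.finite_Icc _ _)
    refine (hfin.image fun p => p.1.out * t ^ p.2).subset fun g hg => ?_
    exact ⟨(g, k g), ⟨trivial, abs_le.1 hg⟩, hk' g⟩

namespace IsCoordinate

variable {G : Type*} [Group G] {t : G} {k : G → ℤ}

theorem finite_quotient (hk : IsCoordinate t k) {m : ℕ} (hm : 0 < m) :
    Finite (G ⧸ zpowers (t ^ m)) := by
  have := (hk.finite m).to_subtype
  refine Finite.of_surjective (fun g : {g | |k g| ≤ (m : ℤ)} => ((g : G) : G ⧸ zpowers (t ^ m))) ?_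
  intro q
  obtain ⟨g, rfl⟩ := QuotientGroup.mk_surjective q
  have hm' : (0 : ℤ) < m := by exact_mod_cast hm
  refine ⟨⟨g * t ^ (-(m * (k g / m))), ?_⟩, ?_⟩
  · change |k _| ≤ _
    rw [hk.mul_zpow, abs_le]
    have h1 := Int.emod_add_mul_ediv (k g) m
    have h2 := Int.emod_nonneg (k g) hm'.ne'
    have h3 := Int.emod_lt_of_pos (k g) hm'
    constructor <;> linarith
  · refine QuotientGroup.eq.2 ⟨k g / m, ?_⟩
    simp only [← zpow_natCast, ← zpow_mul]
    rw [mul_inv_rev, inv_mul_cancel_right, ← zpow_neg, neg_neg]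

/-- The difference `k (f * g) - k g` is unchanged when `g` is multiplied on the right by a power of
`t`, so only the finitely many `g` with `k g = 0` matter. -/
theorem exists_bound (hk : IsCoordinate t k) (F T : Finset G) :
    ∃ K : ℕ, (∀ f ∈ F, ∀ g, |k (f * g) - k g| ≤ K) ∧ ∀ u ∈ T, |k u| ≤ K := by
  classical
  have hR := hk.finite 0
  let B : Finset ℕ := ((F ×ˢ hR.toFinset).image fun p => (k (p.1 * p.2)).natAbs) ∪
    T.image fun u => (k u).natAbs
  refine ⟨B.sup id, fun f hf g => ?_, fun u hu => ?_⟩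
  · have hr : g * t ^ (-k g) ∈ hR.toFinset := by
      rw [Set.Finite.mem_toFinset, Set.mem_ofPred_eq, hk.mul_zpow, add_neg_cancel, abs_zero]
    have h1 : (k (f * (g * t ^ (-k g)))).natAbs ≤ B.sup id := by
      refine Finset.le_sup (f := id) (Finset.mem_union_left _ (Finset.mem_image.2
        ⟨(f, g * t ^ (-k g)), Finset.mem_product.2 ⟨hf, hr⟩, rfl⟩))
    rw [← mul_assoc, hk.mul_zpow, ← sub_eq_add_neg] at h1
    rw [Int.abs_eq_natAbs]
    exact_mod_cast h1
  · have h1 : (k u).natAbs ≤ B.sup id :=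
      Finset.le_sup (f := id) (Finset.mem_union_right _ (Finset.mem_image.2 ⟨u, hu, rfl⟩))
    rw [Int.abs_eq_natAbs]
    exact_mod_cast h1

/-- A coloring that repeats the pattern of a long window after a translation by `t ^ m` can be made
periodic without creating new patterns. -/
theorem exists_periodic {A : Type*} (hk : IsCoordinate t k) {F : Finset G} {K m : ℕ}
    (hF : ∀ f ∈ F, ∀ g, |k (f * g) - k g| ≤ K) (hKm : K < m) (c₀ : G → A)
    (hc₀ : ∀ u, |k u| ≤ K → c₀ (u * t ^ m) = c₀ u) :
    ∃ c : G → A, (∀ g, c (g * t ^ m) = c g) ∧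
      (∀ g, ∃ g', ∀ f ∈ F, c (f * g) = c₀ (f * g')) ∧ ∀ u, |k u| ≤ K → c u = c₀ u := by
  have hm : (0 : ℤ) < m := by exact_mod_cast (Nat.zero_le K).trans_lt hKm
  have hKm' : (K : ℤ) < m := by exact_mod_cast hKm
  -- Translates `g` into the fundamental domain `0 ≤ k < m`.
  let c : G → A := fun g => c₀ (g * t ^ (-(m * (k g / m)) : ℤ))
  have hperZ : ∀ g (j : ℤ), c (g * t ^ (m * j)) = c g := by
    intro g j
    simp only [c, hk.mul_zpow]
    rw [Int.add_mul_ediv_left _ _ hm.ne', mul_assoc, ← zpow_add]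
    congr 3
    ring
  -- The repetition `hc₀` extends the agreement by `K` past both ends of the domain, so windows
  -- crossing the seam also show patterns of `c₀`.
  have hwin : ∀ u, -(K : ℤ) ≤ k u → k u ≤ m + K → c u = c₀ u := by
    intro u h1 h2
    rcases lt_or_ge (k u) 0 with h | h
    · have hd : k u / m = -1 := by
        rw [Int.ediv_eq_iff_of_pos hm]
        constructor <;> linarith
      simp only [c, hd]
      rw [mul_neg_one, neg_neg, zpow_natCast]
      exact hc₀ u (abs_le.2 ⟨h1, by linarith⟩)
    rcases lt_or_ge (k u) m with h' | h'
    · have hd : k u / m = 0 := Int.ediv_eq_zero_of_lt h h'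
      simp [c, hd]
    · have hd : k u / m = 1 := by
        rw [Int.ediv_eq_iff_of_pos hm]
        constructor <;> linarith
      simp only [c, hd, mul_one]
      rw [← hc₀ (u * t ^ (-(m : ℤ))), ← zpow_natCast, mul_assoc, ← zpow_add]
      · simp
      · rw [hk.mul_zpow, abs_le]
        constructor <;> linarith
  refine ⟨c, fun g => ?_, fun g => ?_, fun u hu => ?_⟩
  · have := hperZ g 1
    rwa [mul_one, zpow_natCast] at this
  · refine ⟨g * t ^ (m * -(k g / m)), fun f hf => ?_⟩
    rw [← hperZ (f * g) (-(k g / m)), mul_assoc]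
    have h1 := abs_le.1 (hF f hf (g * t ^ (m * -(k g / m))))
    have h2 : k (g * t ^ (m * -(k g / m))) = k g % m := by
      rw [hk.mul_zpow]
      have := Int.emod_add_mul_ediv (k g) m
      linarith
    rw [h2] at h1
    have h3 := Int.emod_nonneg (k g) hm.ne'
    have h4 := Int.emod_lt_of_pos (k g) hm
    exact hwin _ (by linarith) (by linarith)
  · have := abs_le.1 hu
    exact hwin u this.1 (by linarith)

end IsCoordinate

/-! ### Periodic approximation and the odometer -/

namespace CantorDynamics

/-- Infinitely many visits to `W` lie in one right coset of `zpowers t`, so two of them differ by `t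
^ j` with `|j| > K`. If `j` is negative, the later visit serves as starting point. -/
theorem exists_recurrence {G : Type*} [Group G] {t : G} [(zpowers t).FiniteIndex]
    {η : CantorAction G} {x : Cantor}
    (hx : ∀ U : Set Cantor, IsOpen U → U.Nonempty → ∃ g : G, η g x ∈ U) {W : Set Cantor}
    (hW : IsOpen W) (hne : W.Nonempty) (K : ℕ) :
    ∃ y ∈ W, ∃ m : ℕ, K < m ∧ η (t ^ m) y ∈ W := by
  have hinf := infinite_visits hx hW hne
  obtain ⟨q, hq⟩ : ∃ q : G ⧸ zpowers t,
      {g : G | η g x ∈ W ∧ ((g⁻¹ : G) : G ⧸ zpowers t) = q}.Infinite := by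
    by_contra! hcon
    refine hinf ((Set.finite_iUnion hcon).subset fun g hg => ?_)
    exact Set.mem_iUnion.2 ⟨_, hg, rfl⟩
  obtain ⟨g₀, hg₀, hg₀q⟩ := hq.nonempty
  have hfin := (Set.finite_Icc (-(K : ℤ)) K).image fun j : ℤ => t ^ j * g₀
  obtain ⟨g, ⟨hg, hgq⟩, hgn⟩ := hq.exists_notMem_finite hfin
  have hmem : g * g₀⁻¹ ∈ zpowers t := by
    have := QuotientGroup.eq.1 (hgq.trans hg₀q.symm)
    rwa [inv_inv] at this
  obtain ⟨j, hj⟩ := mem_zpowers_iff.1 hmem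
  have hj' : g = t ^ j * g₀ := by rw [hj, inv_mul_cancel_right]
  have hjK : ¬ (-(K : ℤ) ≤ j ∧ j ≤ K) := fun h => hgn ⟨j, h, hj'.symm⟩
  rcases le_total 0 j with h | h
  · lift j to ℕ using h
    refine ⟨η g₀ x, hg₀, j, by omega, ?_⟩
    rw [← Homeomorph.mul_apply, ← map_mul, ← zpow_natCast, ← hj']
    exact hg
  · obtain ⟨n, rfl⟩ : ∃ n : ℕ, j = -(n : ℤ) := ⟨j.natAbs, by omega⟩
    refine ⟨η g x, hg, n, by omega, ?_⟩
    rw [← Homeomorph.mul_apply, ← map_mul, hj', zpow_neg, zpow_natCast, mul_inv_cancel_left]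
    exact hg₀

/-- Transitive actions of virtually cyclic groups are approximated by actions on finite sets. -/
theorem IsTransitive.exists_periodic_coloring {G : Type*} [Group G] [Countable G] {t : G}
    (ht : Function.Injective fun j : ℤ => t ^ j) [(zpowers t).FiniteIndex] {η : CantorAction G}
    (hη : IsTransitive η) {A : Type*} [Finite A] [TopologicalSpace A] [DiscreteTopology A]
    {P : Cantor → A} (hP : Continuous P) (F : Finset G) :
    ∃ (m : ℕ) (c : G → A), 0 < m ∧ (∀ g, c (g * t ^ m) = c g) ∧
      Set.range (fun ω => fun f : F => P (η f ω)) = Set.range fun g => fun f : F => c (f * g) := by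
  classical
  obtain ⟨k, hk⟩ := exists_isCoordinate ht
  obtain ⟨x, hx⟩ := hη.exists_dense_orbit
  let p : Cantor → F → A := fun ω f => P (η f ω)
  have hp : Continuous p := continuous_pi fun f => hP.comp (η f).continuous
  have hvisit : ∀ a : Set.range p, ∃ g : G, p (η g x) = a := by
    rintro ⟨_, ω, rfl⟩
    exact hx (p ⁻¹' {p ω}) ((isOpen_discrete _).preimage hp) ⟨ω, rfl⟩
  choose v hv using hvisit
  let T : Finset G := F * (Set.finite_range v).toFinset
  obtain ⟨K, hKF, hKT⟩ := hk.exists_bound F T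
  -- Points of `W` share the itinerary of `x` for `|k u| ≤ K`, a range containing an occurrence of
  -- every pattern. A return by `t ^ m` is the repetition that `exists_periodic` needs.
  let W : Set Cantor := {ω | ∀ u ∈ (hk.finite K).toFinset, P (η u ω) = P (η u x)}
  have hW : IsOpen W := by
    have : W = ⋂ u ∈ (hk.finite K).toFinset, (fun ω => P (η u ω)) ⁻¹' {P (η u x)} := by
      ext ω
      simp [W]
    rw [this]
    exact isOpen_biInter_finset fun u _ =>
      (isOpen_discrete _).preimage (hP.comp (η u).continuous)
  obtain ⟨y, hy, m, hKm, hm⟩ := exists_recurrence (t := t) hx hW ⟨x, fun _ _ => rfl⟩ K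
  have hwin : ∀ u, |k u| ≤ K → u ∈ (hk.finite K).toFinset := fun u hu => by simpa using hu
  obtain ⟨c, hper, hc, hcy⟩ := hk.exists_periodic hKF hKm (fun g => P (η g y)) (fun u hu => by
    rw [map_mul, Homeomorph.mul_apply, hm u (hwin u hu), hy u (hwin u hu)])
  refine ⟨m, c, (Nat.zero_le K).trans_lt hKm, hper, ?_⟩
  apply Set.Subset.antisymm
  · rintro a ha
    refine ⟨v ⟨a, ha⟩, funext fun f => ?_⟩
    have hu := hKT (f * v ⟨a, ha⟩) (Finset.mul_mem_mul f.2 (by simp))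
    have h1 := congrFun (hv ⟨a, ha⟩) f
    change c (f * v ⟨a, ha⟩) = a f
    rw [hcy _ hu, hy _ (hwin _ hu), map_mul, Homeomorph.mul_apply]
    exact h1
  · rintro _ ⟨g, rfl⟩
    obtain ⟨g', hg'⟩ := hc g
    refine ⟨η g' y, funext fun f => ?_⟩
    change P (η f (η g' y)) = c (f * g)
    rw [hg' f f.2, map_mul, Homeomorph.mul_apply]

/-- The odometer: the action on the completion along the subgroups generated by the powers
of `t`. -/
theorem exists_odometer {G : Type*} [Group G] {t : G}
    (ht : Function.Injective fun j : ℤ => t ^ j) [(zpowers t).FiniteIndex] :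
    ∃ ξ : CantorAction G, IsTransitive ξ ∧ ∀ m : ℕ, 0 < m →
      ∃ q : Cantor → G ⧸ zpowers (t ^ m), (∀ a, IsOpen (q ⁻¹' {a})) ∧
        ∀ g ω, q (ξ g ω) = g • q ω := by
  obtain ⟨k, hk⟩ := exists_isCoordinate ht
  let Y : ℕ → Type _ := fun n => G ⧸ zpowers (t ^ (n + 1))
  let : ∀ n, TopologicalSpace (Y n) := fun n => ⊥
  have : ∀ n, DiscreteTopology (Y n) := fun n => ⟨rfl⟩
  have : ∀ n, Finite (Y n) := fun n => hk.finite_quotient n.succ_pos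
  let : ∀ n, MulAction G (Y n) := fun n =>
    inferInstanceAs (MulAction G (G ⧸ zpowers (t ^ (n + 1))))
  have : ∀ n, ContinuousConstSMul G (Y n) := fun n => ⟨fun g => continuous_of_discreteTopology⟩
  let z : ∀ n, Y n := fun n => ((1 : G) : G ⧸ zpowers (t ^ (n + 1)))
  have hfix : ∀ (g : G) n, (g • z) n = z n ↔ g ∈ zpowers (t ^ (n + 1)) := by
    intro g n
    change ((g * 1 : G) : G ⧸ zpowers (t ^ (n + 1))) = ((1 : G) : G ⧸ zpowers (t ^ (n + 1))) ↔ _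
    rw [eq_comm, QuotientGroup.eq]
    simp
  have hperf : ∀ U : Set (∀ n, Y n), IsOpen U → z ∈ U → ∃ g : G, g • z ∈ U ∧ g • z ≠ z := by
    intro U hU hz
    obtain ⟨I, u, hu, hsub⟩ := isOpen_pi_iff.1 hU z hz
    let N := I.sup id + 1
    -- `n + 1` divides `N!` for `n` in `I`, so these coordinates are fixed; the coordinate of index
    -- `N!` moves, as `N! + 1` does not divide `N!`.
    refine ⟨t ^ N.factorial, hsub fun n hn => ?_, fun h => ?_⟩
    · have hnN : n + 1 ≤ N := Nat.succ_le_succ (Finset.le_sup (f := id) hn)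
      have : (t ^ N.factorial • z) n = z n := by
        rw [hfix]
        obtain ⟨d, hd⟩ := Nat.dvd_factorial n.succ_pos hnN
        rw [hd, pow_mul]
        exact pow_mem (mem_zpowers _) d
      rw [this]
      exact (hu n hn).2
    · have h1 := (hfix _ _).1 (congrFun h N.factorial)
      obtain ⟨j, hj⟩ := mem_zpowers_iff.1 h1
      rw [← zpow_natCast, ← zpow_natCast, ← zpow_mul] at hj
      have h2 := ht hj
      have h3 : ((N.factorial + 1 : ℕ) : ℤ) ∣ (N.factorial : ℕ) := ⟨j, h2.symm⟩
      have h4 := Nat.le_of_dvd N.factorial_pos (Int.natCast_dvd_natCast.1 h3)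
      omega
  obtain ⟨π, ξ, hπ, hrange, heq⟩ := exists_cantorAction_of_isClosed (G := G)
    (closure (MulAction.orbit G z)) isClosed_closure
    ⟨z, subset_closure (MulAction.mem_orbit_self z)⟩
    (by
      intro g w hw
      refine map_mem_closure (f := fun w : ∀ n, Y n => g • w) (continuous_const_smul g) hw ?_
      rintro _ ⟨h, rfl⟩
      exact ⟨g * h, mul_smul g h z⟩)
    (by
      intro w hw U hU hwU
      by_contra! hcon
      obtain ⟨_, hgU, g, rfl⟩ := mem_closure_iff.1 hw U hU hwU
      obtain ⟨h, hh, hne⟩ := hperf ((g • ·) ⁻¹' U) (hU.preimage (continuous_const_smul g)) hgU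
      refine hne (smul_left_cancel g ?_)
      have h1 := hcon (g • z) (subset_closure ⟨g, rfl⟩) hgU
      have h2 := hcon (g • h • z) (subset_closure ⟨g * h, mul_smul g h z⟩) hh
      rw [h1, h2])
  refine ⟨ξ, ?_, fun m hm => ?_⟩
  · refine isTransitive_of_isEmbedding hπ heq ?_
    rintro O₁ O₂ hO₁ hO₂ ⟨w₁, h₁, h₁'⟩ ⟨w₂, h₂, h₂'⟩
    rw [hrange] at h₁' h₂' ⊢
    obtain ⟨_, hg₁, g₁, rfl⟩ := mem_closure_iff.1 h₁' O₁ hO₁ h₁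
    obtain ⟨_, hg₂, g₂, rfl⟩ := mem_closure_iff.1 h₂' O₂ hO₂ h₂
    refine ⟨g₂ * g₁⁻¹, g₁ • z, subset_closure ⟨g₁, rfl⟩, hg₁, ?_⟩
    rwa [mul_smul, inv_smul_smul]
  · obtain ⟨n, rfl⟩ := Nat.exists_eq_succ_of_ne_zero hm.ne'
    refine ⟨fun ω => π ω n, fun a => ?_, fun g ω => congrFun (heq g ω) n⟩
    exact (isOpen_discrete ({a} : Set (Y n))).preimage
      ((continuous_apply n).comp hπ.continuous)

theorem IsTransitive.conjAction {G : Type*} [Group G] {ξ : CantorAction G} (hξ : IsTransitive ξ)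
    (f : HomeoCantor) : IsTransitive (conjAction f ξ) := by
  intro U V hU hUne hV hVne
  obtain ⟨g, _, ⟨u, hu, rfl⟩, huV⟩ := hξ (f ⁻¹' U) (f ⁻¹' V) (hU.preimage f.continuous)
    (hUne.preimage f.surjective) (hV.preimage f.continuous) (hVne.preimage f.surjective)
  exact ⟨g, f (ξ g u), ⟨f u, hu, by simp [conjAction_apply]⟩, huV⟩

theorem hasDenseConjClass_of_zpowers {G : Type*} [Group G] [Countable G] {t : G}
    (ht : Function.Injective fun j : ℤ => t ^ j) [(zpowers t).FiniteIndex] :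
    HasDenseConjClass G := by
  classical
  obtain ⟨ξ, hξ, hq⟩ := exists_odometer ht
  refine ⟨ξ, hξ, fun η => mem_closure_iff_nhds.2 fun U hU => ?_⟩
  obtain ⟨V, hV, hVU⟩ := mem_nhds_subtype _ _ _ |>.1 hU
  obtain ⟨F, N, hFN⟩ := exists_forall_coord_eq_of_mem_nhds hV
  let P : Cantor → Fin N → Bool := fun ω i => ω i
  have hP : Continuous P := by fun_prop
  -- With `1` in the window, the homeomorphism `h` found below also satisfies `P ∘ h = Q`. This
  -- turns equality of patterns into `P (h (ξ f ω)) = P (η f (h ω))`, the required closeness.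
  obtain ⟨m, c, hm, hper, hrange⟩ :=
    IsTransitive.exists_periodic_coloring ht η.2 hP (insert 1 F)
  obtain ⟨q, hqo, hqe⟩ := hq m hm
  let c' : G ⧸ zpowers (t ^ m) → Fin N → Bool := fun a => c a.out
  have hc' : ∀ g : G, c' g = c g := by
    have hperZ : ∀ (j : ℤ) g, c (g * (t ^ m) ^ j) = c g := by
      intro j
      induction j using Int.induction_on with
      | zero => simp
      | succ j ih =>
        intro g
        rw [zpow_add_one, ← mul_assoc, hper, ih]
      | pred j ih =>
        intro g
        rw [← hper, mul_assoc, ← zpow_add_one, sub_add_cancel, ih]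
    intro g
    obtain ⟨⟨_, j, rfl⟩, hj⟩ := QuotientGroup.mk_out_eq_mul (zpowers (t ^ m)) g
    simp only [c', hj]
    exact hperZ j g
  let Q : Cantor → Fin N → Bool := fun ω => c' (q ω)
  have hQ : Continuous Q := by
    refine continuous_discrete_rng.2 fun a => ?_
    have : Q ⁻¹' {a} = ⋃ b ∈ {b | c' b = a}, q ⁻¹' {b} := by
      ext ω
      simp [Q]
    rw [this]
    exact isOpen_biUnion fun b _ => hqo b
  have hQξ : ∀ (f g : G) ω, q ω = g → Q (ξ f ω) = c (f * g) := fun f g ω hω => by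
    rw [← hc']
    change c' (q (ξ f ω)) = _
    rw [hqe, hω]
    rfl
  obtain ⟨h, hh⟩ := exists_homeomorph_comp_eq
    (p := fun ω => fun f : (insert 1 F : Finset G) => P ((η : CantorAction G) f ω))
    (q := fun ω => fun f : (insert 1 F : Finset G) => Q (ξ f ω))
    (continuous_pi fun f => hP.comp ((η : CantorAction G) f).continuous)
    (continuous_pi fun f => hQ.comp (ξ f).continuous) (by
      rw [hrange]
      apply Set.Subset.antisymm
      · rintro _ ⟨g, rfl⟩
        obtain ⟨g₀, hg₀⟩ := QuotientGroup.mk_surjective (q fun _ => true)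
        refine ⟨ξ (g * g₀⁻¹) fun _ => true, funext fun f => hQξ f g _ ?_⟩
        rw [hqe, ← hg₀]
        change ((g * g₀⁻¹ * g₀ : G) : G ⧸ zpowers (t ^ m)) = g
        rw [inv_mul_cancel_right]
      · rintro _ ⟨ω, rfl⟩
        obtain ⟨g, hg⟩ := QuotientGroup.mk_surjective (q ω)
        exact ⟨g, funext fun f => (hQξ f g ω hg.symm).symm⟩)
  have hone : ∀ ω, P (h ω) = Q ω := by
    intro ω
    have := congrFun (hh ω) ⟨1, Finset.mem_insert_self 1 F⟩
    simpa using this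
  have hconj : conjAction h ξ ∈ V := by
    refine hFN _ fun f hf ω i hi => ?_
    have h1 := congrFun (hh (h.symm ω)) ⟨f, Finset.mem_insert_of_mem hf⟩
    have h2 := hone (ξ f (h.symm ω))
    simp only [Homeomorph.apply_symm_apply] at h1
    exact congrFun (h2.trans h1.symm) ⟨i, hi⟩
  refine ⟨⟨conjAction h ξ, hξ.conjAction h⟩, hVU hconj, h, rfl⟩

end CantorDynamics

/-! ### The theorem -/

theorem theorem8p13 (G : Type*) [Group G] [Infinite G] (hG : IsVirtuallyPolycyclic G) :
    CantorDynamics.HasDenseConjClass G ↔ IsVirtuallyCyclic G := by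
  have hcount : Countable G := by
    obtain ⟨P, hP, hPp⟩ := hG
    have := Group.fg_of_finiteIndex_fg P ((Group.fg_iff_subgroup_fg P).1 hPp.isPolyCyc.fg)
    exact countable_of_fg G
  constructor
  · intro h
    by_contra hcyc
    obtain ⟨A, B, _, _, hA, hB, hAB⟩ := hG.exists_isolable_pair hcyc
    exact CantorDynamics.not_hasDenseConjClass hA hB hAB h
  · rintro ⟨H, hH, hcyc⟩
    obtain ⟨t, ht⟩ := (Subgroup.isCyclic_iff_exists_zpowers_eq_top H).1 hcyc
    subst ht
    have hinf : Infinite (zpowers t) := by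
      by_contra hcon
      rw [not_infinite_iff_finite] at hcon
      have : Finite G := (Subgroup.finite_iff_finite_and_finiteIndex (zpowers t)).2 ⟨hcon, hH⟩
      exact not_finite G
    refine CantorDynamics.hasDenseConjClass_of_zpowers (t := t) ?_
    rw [injective_zpow_iff_not_isOfFinOrder]
    exact infinite_zpowers.1 (Set.infinite_coe_iff.1 hinf)
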